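/- Let $R$ be a reduced irreducible (finite, crystallographic) root system over a field $K$ of characteristic $0$, with a choice of simple roots and corresponding set of positive roots $R_+$, and let $\lambda_{ad}$ be its highest (maximal) root. Let $\rho=\frac12\sum_{\alpha\in R_+}\alpha$ be the Weyl vector, and let $B=(\,,)$ be the minimal Weyl-invariant symmetric bilinear form, i.e. the one with $(\lambda_{ad},\lambda_{ad})=2$. Consider the rational function of $z$ $$F^B(\lambda_{ad},z)=\prod_{\mu\in R_+}\frac{1-(\lambda_{ad}+\rho,\mu)^2z}{1-(\rho,\mu)^2z}.$$ Then $R$ is of (at least) one of the types $$\begin{array}{c|c|c|c} \text{Type}&\alpha&\beta&\gamma\\ \hline A_n\ (n\ge1)&-2&2&n+1\\ B_n\ (n\ge2)&-2&4&2n-3\\ C_n\ (n\ge2)&-2&1&n+2\\ D_n\ (n\ge3)&-2&4&2n-4\\ G_2&-2&10/3&8/3\\ F_4&-2&5&6\\ E_6&-2&6&8\\ E_7&-2&8&12\\ E_8&-2&12&20 \end{array}$$ and for every type that $R$ has (the only coincidences being $B_2=C_2$ and $A_3=D_3$), with $\alpha,\beta,\gamma$ from the corresponding row and $t=\alpha+\beta+\gamma$,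 one has the identity of rational functions $$F^B(\lambda_{ad},z)=\frac{(4-(2t-\alpha)^2z)(4-(2t-\beta)^2z)(4-(2t-\gamma)^2z)}{(4-\alpha^2z)(4-\beta^2z)(4-\gamma^2z)}.$$ -/

import Mathlib

/-- The Cartan–Killing types, each with the range of ranks in which it is used.
The index is the rank; `B 2 = C 2` and `A 3 = D 3` are two names for the same root system. -/
inductive SimpleType : Type
  | A (n : ℕ) (hn : 1 ≤ n)
  | B (n : ℕ) (hn : 2 ≤ n)
  | C (n : ℕ) (hn : 2 ≤ n)
  | D (n : ℕ) (hn : 3 ≤ n)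
  | G₂
  | F₄
  | E₆
  | E₇
  | E₈

namespace SimpleType

/-- The rank of a type. -/
def rank : SimpleType → ℕ
  | A n _ => n
  | B n _ => n
  | C n _ => n
  | D n _ => n
  | G₂ => 2
  | F₄ => 4
  | E₆ => 6
  | E₇ => 7
  | E₈ => 8

/-- The standard Cartan matrix of a type, with entries `⟨αᵢ, αⱼ^∨⟩`
(so in type `B` the last simple root is the short one, in type `C` the long one). -/
def cartan : (T : SimpleType) → Matrix (Fin T.rank) (Fin T.rank) ℤ
  | A n _ => CartanMatrix.A n
  | B n _ => CartanMatrix.B n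
  | C n _ => CartanMatrix.C n
  | D n _ => CartanMatrix.D n
  | G₂ => CartanMatrix.G₂
  | F₄ => CartanMatrix.F₄
  | E₆ => CartanMatrix.E₆
  | E₇ => CartanMatrix.E₇
  | E₈ => CartanMatrix.E₈

/-- Vogel's parameter `α`. -/
def vogelAlpha (K : Type*) [Field K] : SimpleType → K
  | _ => -2

/-- Vogel's parameter `β`. -/
def vogelBeta (K : Type*) [Field K] : SimpleType → K
  | A _ _ => 2
  | B _ _ => 4
  | C _ _ => 1
  | D _ _ => 4
  | G₂ => 10 / 3
  | F₄ => 5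
  | E₆ => 6
  | E₇ => 8
  | E₈ => 12

/-- Vogel's parameter `γ`. -/
def vogelGamma (K : Type*) [Field K] : SimpleType → K
  | A n _ => (n : K) + 1
  | B n _ => 2 * (n : K) - 3
  | C n _ => (n : K) + 2
  | D n _ => 2 * (n : K) - 4
  | G₂ => 8 / 3
  | F₄ => 6
  | E₆ => 8
  | E₇ => 12
  | E₈ => 20

/-- The sum `t = α + β + γ` of Vogel's parameters. -/
def vogelT (K : Type*) [Field K] (T : SimpleType) : K :=
  T.vogelAlpha K + T.vogelBeta K + T.vogelGamma K

end SimpleType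

open RatFunc in
/-- The factor `(4 - (2t - x)² z) / (4 - x² z)`, a rational function of `z`. -/
noncomputable def vogelFactor {K : Type*} [Field K] (t x : K) : RatFunc K :=
  (4 - C ((2 * t - x) ^ 2) * X) / (4 - C (x ^ 2) * X)

namespace RootPairing

variable {ι K M N : Type*} [Field K] [AddCommGroup M] [Module K M] [AddCommGroup N] [Module K N]

/-- A base of a root system exhibits it as being of type `T` if its Cartan matrix is, for some
ordering of the simple roots, the standard one. -/
def Base.HasType {P : RootPairing ι K M N} [P.IsCrystallographic] (b : P.Base)
    (T : SimpleType) : Prop :=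
  ∃ e : b.support ≃ Fin T.rank, ∀ i j : b.support, b.cartanMatrix i j = T.cartan (e i) (e j)

/-- The `θ`-th root is the highest (maximal) root: for every root, the difference of the two is
a sum of simple roots with nonnegative integer coefficients. -/
def Base.IsHighestRoot {P : RootPairing ι K M N} (b : P.Base) (θ : ι) : Prop :=
  ∀ i : ι, P.root θ - P.root i ∈ AddSubmonoid.closure (P.root '' b.support)

open Classical in
/-- The half-sum `ρ` of the positive roots. -/
noncomputable def Base.weylVector [Fintype ι] [CharZero K] {P : RootPairing ι K M N}
    (b : P.Base) : M :=
  (1 / 2 : K) • ∑ i with b.IsPos i, P.root i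

open Classical RatFunc in
/-- `F^B(μ, z) = ∏ (1 - (μ + ρ, α)² z) / (1 - (ρ, α)² z)`, the product being over all positive
roots `α`, as a rational function of `z`. -/
noncomputable def Base.casimirProduct [Fintype ι] [CharZero K] {P : RootPairing ι K M N}
    (b : P.Base) (B : P.InvariantForm) (μ : M) : RatFunc K :=
  ∏ i with b.IsPos i,
    (1 - C (B.form (μ + b.weylVector) (P.root i) ^ 2) * X) /
      (1 - C (B.form b.weylVector (P.root i) ^ 2) * X)

end RootPairing

/-! The theorem has two independent halves: the Cartan–Killing classification, and the evaluation of
the product for each type.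

Classification (`Matrix.IsFiniteCartan.exists_isOfType`) is by induction on the number of vertices.
A Dynkin diagram of finite type has a vertex `p` with at most one neighbour, since otherwise the
all-ones vector would violate positivity. Removing `p` leaves a connected diagram of finite type,
whose type is known by induction. It remains to see how `p` can be attached to a vertex `q` of a
diagram with Cartan matrix `C`. Positivity forces `A_pq A_qp (C⁻¹)_qq < 2` (`mul_mul_lt`, a Schur
complement argument), and the explicit inverses of the standard Cartan matrices leave only
attachments that give another standard diagram.

For the product, only the integers obtained by pairing `ρ` and `θ` with the positive roots matter.
Since `⟨ρ, αⱼ^∨⟩ = 1`, the form satisfies `(ρ, αⱼ) = κ lⱼ`, where `lⱼ` is proportional to the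
squared length of `αⱼ` and `κ` is one constant, fixed by `(θ, θ) = 2`. All the data can therefore be
read off in a concrete list of vectors with the right Cartan matrix. `RootModel` records what such a
list must satisfy: it is stable under simple reflections, apart from each simple root under its own,
and every non-simple member can be lowered by one of them. These conditions force it to be the set
of positive roots, and `casimirProduct_eq` transports the product to it.

In a model almost all numerators cancel against denominators. For the classical types `θ` involves
one or two coordinates and the products over the remaining coordinate telescope; for the exceptional
types the cancellation is an equality of finite multisets, checked by evaluation. At most three
factors survive above and below, and `4 - x² z = 4 (1 - (x / 2)² z)` identifies them with Vogel's.
-/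

/-! ### Cartan matrices of finite type -/

namespace Matrix

/-- The defining properties of the Cartan matrix of an irreducible finite root system. -/
structure IsFiniteCartan {I : Type*} [Fintype I] (A : Matrix I I ℤ) : Prop where
  diag (i : I) : A i i = 2
  nonpos {i j : I} : i ≠ j → A i j ≤ 0
  eq_zero {i j : I} : A i j = 0 → A j i = 0
  posDef : ∃ d : I → ℤ, (∀ i, 0 < d i) ∧ (∀ i j, d i * A i j = d j * A j i) ∧
    ∀ x : I → ℤ, x ≠ 0 → 0 < ∑ i, d i * x i * ∑ j, A i j * x j
  connected (p : I → Prop) {i j : I} : p i → (∀ i j, p i → A j i ≠ 0 → p j) → p j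

/-- A square integer matrix is of type `T` if it is, up to reindexing, the standard one. -/
def IsOfType {I : Type*} (A : Matrix I I ℤ) (T : SimpleType) : Prop :=
  ∃ e : I ≃ Fin T.rank, ∀ i j, A i j = T.cartan (e i) (e j)

namespace IsFiniteCartan

variable {I J : Type*} [Fintype I] [Fintype J] {A : Matrix I I ℤ}

lemma reindex (hA : A.IsFiniteCartan) (e : J ≃ I) : (A.submatrix e e).IsFiniteCartan where
  diag i := hA.diag _
  nonpos h := hA.nonpos (e.injective.ne h)
  eq_zero h := hA.eq_zero h
  posDef := by
    obtain ⟨d, hd, hs, hp⟩ := hA.posDef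
    refine ⟨d ∘ e, fun i ↦ hd _, fun i j ↦ hs _ _, fun x hx ↦ ?_⟩
    have := hp (x ∘ e.symm) (fun h ↦ hx <| by
      ext i; simpa using congr_fun h (e i))
    rw [← e.sum_comp] at this
    simp_rw [← e.sum_comp (fun j ↦ A _ j * _)] at this
    simpa using this
  connected p i j hi hp := by
    have := hA.connected (fun k ↦ p (e.symm k)) (i := e i) (j := e j) (by simpa) fun k l hk hl ↦
      hp _ _ hk (by simpa using hl)
    simpa using this

/-- Some vertex of the Dynkin diagram has at most one neighbour. -/
lemma exists_leaf [Nonempty I] (hA : A.IsFiniteCartan) :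
    ∃ p, ∀ q q', q ≠ p → q' ≠ p → A p q ≠ 0 → A p q' ≠ 0 → q = q' := by
  classical
  by_contra! h
  obtain ⟨d, hd, -, hp⟩ := hA.posDef
  -- Test the form on the all-ones vector: with two neighbours at every vertex each row sum is at
  -- most `2 - 1 - 1 = 0`.
  refine (hp 1 one_ne_zero).not_ge (Finset.sum_nonpos fun p _ ↦ ?_)
  simp only [Pi.one_apply, mul_one]
  refine mul_nonpos_of_nonneg_of_nonpos (hd p).le ?_
  obtain ⟨q, q', hq, hq', h0, h0', hne⟩ := h p
  have h1 := hA.nonpos hq.symm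
  have h2 := hA.nonpos hq'.symm
  have h3 := hA.diag p
  have h4 : ∑ j ∈ ({p, q, q'} : Finset I)ᶜ, A p j ≤ 0 := Finset.sum_nonpos fun j hj ↦
    hA.nonpos (by rintro rfl; simp at hj)
  rw [← Finset.sum_add_sum_compl {p, q, q'}, Finset.sum_insert (by grind),
    Finset.sum_insert (by grind), Finset.sum_singleton]
  lia

/-- Removing a vertex with at most one neighbour leaves a Cartan matrix of finite type. -/
lemma of_option {A : Matrix (Option J) (Option J) ℤ} (hA : A.IsFiniteCartan)
    (h : ∀ q q', A none (some q) ≠ 0 → A none (some q') ≠ 0 → q = q') :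
    (A.submatrix some some).IsFiniteCartan where
  diag i := hA.diag _
  nonpos h := hA.nonpos (by simpa)
  eq_zero h := hA.eq_zero h
  posDef := by
    obtain ⟨d, hd, hs, hp⟩ := hA.posDef
    refine ⟨d ∘ some, fun i ↦ hd _, fun i j ↦ hs _ _, fun x hx ↦ ?_⟩
    have := hp (fun o ↦ o.elim 0 x) (fun h ↦ hx <| by ext i; exact congr_fun h (some i))
    simpa [Fintype.sum_option] using this
  connected p i j hi hp := by
    -- Extend `p` to the removed vertex by its value at the only neighbour: a path through a leaf
    -- returns to where it came from.
    have := hA.connected (fun o ↦ o.elim (∃ q, p q ∧ A none (some q) ≠ 0) p) (i := some i)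
      (j := some j) hi ?_
    · exact this
    · rintro (_ | k) (_ | l) hk hl
      · exact hk
      · obtain ⟨q, hq, hq'⟩ := hk
        have : A none (some l) ≠ 0 := fun h ↦ hl (hA.eq_zero h)
        exact h q l hq' this ▸ hq
      · exact ⟨k, hk, hl⟩
      · exact hp k l hk hl

/-- A new vertex can only be attached to a vertex `q` of a diagram if `A_pq A_qp (C⁻¹)_qq < 2`,
where `C` is the Cartan matrix of that diagram; `w / c` stands for the `q`-th column of `C⁻¹`. -/
lemma mul_mul_lt {A : Matrix (Option J) (Option J) ℤ} (hA : A.IsFiniteCartan) (q : J)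
    (h : ∀ j, j ≠ q → A none (some j) = 0) (w : J → ℤ) (c : ℤ) (hw : ∀ i, 0 ≤ w i)
    (hwq : 0 < w q) (hc : ∀ i, i ≠ q → ∑ j, A (some i) (some j) * w j ≤ 0)
    (hcq : ∑ j, A (some q) (some j) * w j ≤ c) :
    A none (some q) * A (some q) none * w q < 2 * c := by
  classical
  obtain ⟨d, hd, hs, hp⟩ := hA.posDef
  set a := A none (some q)
  set b := A (some q) none
  -- The vector is `2w` on the diagram, and its value `-a w_q` at the new vertex makes the row of
  -- the new vertex vanish. What remains is at most `2 d_q w_q (2c - a b w_q)`. Only upper bounds on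
  -- the rows of `C w` enter, so `w` need not be an exact column.
  have key := hp (fun o ↦ o.elim (-(a * w q)) (fun j ↦ 2 * w j)) (fun h ↦ by
    have := congr_fun h (some q)
    simp at this; lia)
  rw [Fintype.sum_option] at key
  have e1 : ∑ j, A none j *
      (fun o ↦ Option.elim o (-(a * w q)) (fun j ↦ 2 * w j) : _ → ℤ) j = 0 := by
    rw [Fintype.sum_option, Finset.sum_eq_single q (fun j _ hj ↦ by simp [h j hj]) (by simp)]
    simp only [Option.elim, hA.diag]; ring
  rw [e1, mul_zero, zero_add] at key
  have hdq := hd (some q)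
  have hab : d none * a = d (some q) * b := hs _ _
  have e2 : ∑ i, d (some i) * (2 * w i) * ∑ j, A (some i) j *
      (fun o ↦ Option.elim o (-(a * w q)) (fun j ↦ 2 * w j) : _ → ℤ) j ≤
      d (some q) * (2 * w q) * (2 * c - a * b * w q) := by
    rw [← Finset.add_sum_erase _ _ (Finset.mem_univ q)]
    have : ∑ i ∈ Finset.univ.erase q, d (some i) * (2 * w i) * ∑ j, A (some i) j *
      (fun o ↦ Option.elim o (-(a * w q)) (fun j ↦ 2 * w j) : _ → ℤ) j ≤ 0 := by
      refine Finset.sum_nonpos fun i hi ↦ ?_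
      have hiq : i ≠ q := by simpa using hi
      refine mul_nonpos_of_nonneg_of_nonpos (mul_nonneg (hd _).le (by linarith [hw i])) ?_
      rw [Fintype.sum_option, hA.eq_zero (h i hiq)]
      simp only [Option.elim, zero_mul, zero_add, mul_left_comm _ (2 : ℤ), ← Finset.mul_sum]
      linarith [hc i hiq]
    have h2 : ∑ j, A (some q) j *
      (fun o ↦ Option.elim o (-(a * w q)) (fun j ↦ 2 * w j) : _ → ℤ) j ≤ 2 * c - a * b * w q := by
      rw [Fintype.sum_option]
      simp only [Option.elim, mul_left_comm _ (2 : ℤ), ← Finset.mul_sum]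
      change b * _ + _ ≤ _
      linarith
    have h3 := mul_le_mul_of_nonneg_left h2 (a := d (some q) * (2 * w q)) (by positivity)
    simp only [Option.elim] at *
    linarith
  simp only [Option.elim] at key e2
  have h4 : 0 < d (some q) * (2 * w q) * (2 * c - a * b * w q) := lt_of_lt_of_le key e2
  have h5 : 0 < 2 * c - a * b * w q := pos_of_mul_pos_right h4 (by positivity)
  lia

/-- The unit vector at `q` with `c = 2` in `mul_mul_lt` gives a product less than 4, and both
entries are negative integers. -/
lemma bond {A : Matrix (Option J) (Option J) ℤ} (hA : A.IsFiniteCartan) (q : J)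
    (hq : A none (some q) ≠ 0) (h : ∀ j, j ≠ q → A none (some j) = 0) :
    (A none (some q) = -1 ∧ A (some q) none = -1) ∨
    (A none (some q) = -1 ∧ A (some q) none = -2) ∨
    (A none (some q) = -2 ∧ A (some q) none = -1) ∨
    (A none (some q) = -1 ∧ A (some q) none = -3) ∨
    (A none (some q) = -3 ∧ A (some q) none = -1) := by
  classical
  have key := hA.mul_mul_lt q h (Pi.single q 1) 2 (fun i ↦ by
      by_cases hi : i = q
      · subst hi; simp
      · simp [hi]) (by simp)
    (fun i hi ↦ by simpa [Pi.single_apply] using hA.nonpos (by simpa using hi))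
    (by simp [Pi.single_apply, hA.diag])
  simp only [Pi.single_eq_same, mul_one] at key
  have h1 := hA.nonpos (i := none) (j := some q) (by simp)
  have h2 := hA.nonpos (i := some q) (j := none) (by simp)
  have h3 : A (some q) none ≠ 0 := fun h ↦ hq (hA.eq_zero h)
  generalize A none (some q) = a at *
  generalize A (some q) none = b at *
  have ha : -4 < a := by nlinarith [show b ≤ -1 by lia]
  have hb : -4 < b := by nlinarith [show a ≤ -1 by lia]
  interval_cases a <;> interval_cases b <;> simp_all

/-- Recognising the type of a diagram obtained by attaching one vertex. -/
lemma isOfType_of_bijective {n : ℕ} {A : Matrix (Option (Fin n)) (Option (Fin n)) ℤ}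
    (hA : A.IsFiniteCartan) (q : Fin n) (h : ∀ j, j ≠ q → A none (some j) = 0) (T : SimpleType)
    (f : Option (Fin n) → Fin T.rank) (hf : f.Bijective)
    (h1 : ∀ i j, A (some i) (some j) = T.cartan (f (some i)) (f (some j)))
    (h0 : T.cartan (f none) (f none) = 2)
    (h2 : T.cartan (f none) (f (some q)) = A none (some q))
    (h3 : T.cartan (f (some q)) (f none) = A (some q) none)
    (h4 : ∀ j, j ≠ q → T.cartan (f none) (f (some j)) = 0 ∧ T.cartan (f (some j)) (f none) = 0) :
    A.IsOfType T := by
  refine ⟨Equiv.ofBijective f hf, ?_⟩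
  rintro (_ | i) (_ | j)
  · simp [hA.diag, h0]
  · by_cases hj : j = q
    · simp [hj, h2]
    · simp [h j hj, h4 j hj]
  · by_cases hj : i = q
    · simp [hj, h3]
    · simp [hA.eq_zero (h i hj), h4 i hj]
  · simpa using h1 i j

end IsFiniteCartan

end Matrix

/-! ### Bounds for attaching a vertex to a diagram of type A, B, C or D -/

namespace Matrix

lemma IsOfType.of_submatrix {I J : Type*} {A : Matrix I I ℤ} {T : SimpleType} (e : J ≃ I)
    (h : (A.submatrix e e).IsOfType T) : A.IsOfType T := by
  obtain ⟨f, hf⟩ := h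
  exact ⟨e.symm.trans f, fun i j ↦ by simpa using hf (e.symm i) (e.symm j)⟩

namespace IsFiniteCartan

section bounds

variable {I : Type*} [Fintype I] [DecidableEq I] {A : Matrix I I ℤ}

/-- Off-diagonal entries are nonpositive, so dropping terms off the diagonal can only increase a row
sum. Naming the neighbours of a vertex is then enough, without showing that the other entries
vanish. -/
lemma sum_mul_le (hA : A.IsFiniteCartan) {w : I → ℤ} (hw : ∀ i, 0 ≤ w i) (S : Finset I) {i : I}
    (hi : i ∈ S) : ∑ j, A i j * w j ≤ ∑ j ∈ S, A i j * w j := by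
  rw [← Finset.sum_add_sum_compl S]
  have : ∑ j ∈ Sᶜ, A i j * w j ≤ 0 := Finset.sum_nonpos fun j hj ↦
    mul_nonpos_of_nonpos_of_nonneg (hA.nonpos (by rintro rfl; simp_all)) (hw j)
  lia

lemma sum_mul_le_one (hA : A.IsFiniteCartan) {w : I → ℤ} (hw : ∀ i, 0 ≤ w i) (i : I) :
    ∑ j, A i j * w j ≤ 2 * w i :=
  (hA.sum_mul_le hw {i} (by simp)).trans (by simp [hA.diag])

lemma sum_mul_le_two (hA : A.IsFiniteCartan) {w : I → ℤ} (hw : ∀ i, 0 ≤ w i) (i a : I)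
    (ha : a ≠ i) : ∑ j, A i j * w j ≤ 2 * w i + A i a * w a :=
  (hA.sum_mul_le hw {i, a} (by simp)).trans <| by
    rw [Finset.sum_insert (by simp [ha.symm]), Finset.sum_singleton, hA.diag]

lemma sum_mul_le_three (hA : A.IsFiniteCartan) {w : I → ℤ} (hw : ∀ i, 0 ≤ w i) (i a b : I)
    (ha : a ≠ i) (hb : b ≠ i) (hab : a ≠ b) :
    ∑ j, A i j * w j ≤ 2 * w i + A i a * w a + A i b * w b :=
  (hA.sum_mul_le hw {i, a, b} (by simp)).trans <| by
    rw [Finset.sum_insert (by simp [ha.symm, hb.symm]), Finset.sum_insert (by simp [hab]),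
      Finset.sum_singleton, hA.diag]
    lia

lemma sum_mul_le_four (hA : A.IsFiniteCartan) {w : I → ℤ} (hw : ∀ i, 0 ≤ w i) (i a b c : I)
    (ha : a ≠ i) (hb : b ≠ i) (hc : c ≠ i) (hab : a ≠ b) (hac : a ≠ c) (hbc : b ≠ c) :
    ∑ j, A i j * w j ≤ 2 * w i + A i a * w a + A i b * w b + A i c * w c :=
  (hA.sum_mul_le hw {i, a, b, c} (by simp)).trans <| by
    rw [Finset.sum_insert (by simp [ha.symm, hb.symm, hc.symm]),
      Finset.sum_insert (by simp [hab, hac]), Finset.sum_insert (by simp [hbc]),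
      Finset.sum_singleton, hA.diag]
    lia

end bounds

/-- Attach the new vertex at the end of the list of vertices. -/
def snoc (n : ℕ) (o : Option (Fin n)) : Fin (n + 1) := o.elim (Fin.last n) Fin.castSucc

/-- Attach the new vertex at the start of the list of vertices. -/
def cons (n : ℕ) (o : Option (Fin n)) : Fin (n + 1) := o.elim 0 Fin.succ

lemma snoc_bijective (n : ℕ) : (snoc n).Bijective := by
  have : snoc n = (finSuccEquivLast (n := n)).symm := by ext o; cases o <;> simp [snoc]
  exact this ▸ Equiv.bijective _

lemma cons_bijective (n : ℕ) : (cons n).Bijective := by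
  have : cons n = (finSuccEquiv n).symm := by ext o; cases o <;> simp [cons]
  exact this ▸ Equiv.bijective _

variable {n : ℕ} {A : Matrix (Option (Fin n)) (Option (Fin n)) ℤ}

/-- The weight `w` is `n + 1` times column `q` of the inverse, whose entries, counting from 0, are
`(min + 1) (n - max) / (n + 1)`. -/
lemma bound_A (hA : A.IsFiniteCartan) (hn : (A.submatrix some some).IsFiniteCartan) (q : Fin n)
    (h : ∀ i j, A (some i) (some j) = CartanMatrix.A n i j)
    (hq : ∀ j, j ≠ q → A none (some j) = 0) :
    A none (some q) * A (some q) none * ((q + 1) * (n - q)) < 2 * (n + 1) := by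
  have hqn := q.2
  let w (j : Fin n) : ℤ := if j ≤ q then (j + 1) * (n - q) else (q + 1) * (n - j)
  have hw (i) : 0 ≤ w i := by
    have := i.2
    simp only [w]; split_ifs <;> apply mul_nonneg <;> lia
  have hwq : w q = (q + 1) * (n - q) := by simp [w]
  have key (i : Fin n) : ∑ j, A (some i) (some j) * w j ≤ if i = q then (n : ℤ) + 1 else 0 := by
    have hi := i.2
    by_cases h0 : (i : ℕ) = 0
    · by_cases h1 : (i : ℕ) + 1 = n
      · refine (hn.sum_mul_le_one hw i).trans (le_of_eq ?_)
        obtain rfl : i = q := by ext; lia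
        simp [hwq, h0, show (n : ℤ) = 1 by lia]
      · refine (hn.sum_mul_le_two hw i ⟨i + 1, by lia⟩ (by simp [Fin.ext_iff])).trans (le_of_eq ?_)
        simp only [submatrix_apply, h, CartanMatrix.A, of_apply, Fin.ext_iff]
        simp only [w, Fin.le_def, h0]
        split_ifs <;> lia
    · by_cases h1 : (i : ℕ) + 1 = n
      · refine (hn.sum_mul_le_two hw i ⟨i - 1, by lia⟩ (by simp [Fin.ext_iff]; lia)).trans
          (le_of_eq ?_)
        simp only [submatrix_apply, h, CartanMatrix.A, of_apply, Fin.ext_iff]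
        simp only [w, Fin.le_def]
        have e1 : ((i - 1 : ℕ) : ℤ) = i - 1 := by lia
        have e2 : (n : ℤ) = i + 1 := by lia
        split_ifs <;> first
          | lia
          | (rw [e1, e2]; first
            | ring1
            | (rw [show (q : ℤ) = i by lia]; ring1)
            | (rw [show (q : ℤ) = i - 1 by lia]; ring1))
      · refine (hn.sum_mul_le_three hw i ⟨i - 1, by lia⟩ ⟨i + 1, by lia⟩
          (by simp [Fin.ext_iff]; lia) (by simp [Fin.ext_iff])
          (by simp [Fin.ext_iff])).trans (le_of_eq ?_)
        simp only [submatrix_apply, h, CartanMatrix.A, of_apply, Fin.ext_iff]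
        simp only [w, Fin.le_def]
        have e1 : ((i - 1 : ℕ) : ℤ) = i - 1 := by lia
        split_ifs <;> first
          | lia
          | (push_cast [e1]; first
            | ring1
            | (rw [show (q : ℤ) = i by lia]; ring1)
            | (rw [show (q : ℤ) = i - 1 by lia]; ring1))
  have := hA.mul_mul_lt q hq w (n + 1) hw (by rw [hwq]; apply mul_pos <;> lia)
    (fun i hi ↦ by simpa [hi] using key i) (by simpa using key q)
  rwa [hwq] at this

end IsFiniteCartan

end Matrix

namespace Matrix

namespace IsFiniteCartan

variable {n : ℕ} {A : Matrix (Option (Fin n)) (Option (Fin n)) ℤ}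

/-- Here `w` is twice column `q` of the inverse: it grows linearly up to `q`, is then constant, and
is halved at the short root at the end. -/
lemma bound_B (hA : A.IsFiniteCartan) (hn : (A.submatrix some some).IsFiniteCartan) (q : Fin n)
    (h2 : 2 ≤ n) (h : ∀ i j, A (some i) (some j) = CartanMatrix.B n i j)
    (hq : ∀ j, j ≠ q → A none (some j) = 0) :
    A none (some q) * A (some q) none *
      (if (q : ℕ) + 1 = n then (n : ℤ) else 2 * ((q : ℤ) + 1)) < 4 := by
  have hqn := q.2
  let w (j : Fin n) : ℤ := if (j : ℕ) + 1 = n then q + 1 else 2 * min ((j : ℤ) + 1) (q + 1)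
  have hw (i) : 0 ≤ w i := by simp only [w]; split_ifs <;> omega
  have hwq : w q = if (q : ℕ) + 1 = n then (n : ℤ) else 2 * ((q : ℤ) + 1) := by
    simp only [w]; split_ifs <;> omega
  have key (i : Fin n) : ∑ j, A (some i) (some j) * w j ≤ if i = q then 2 else 0 := by
    have hi := i.2
    by_cases h0 : (i : ℕ) = 0
    · refine (hn.sum_mul_le_two hw i ⟨i + 1, by omega⟩ (by simp [Fin.ext_iff])).trans ?_
      simp only [submatrix_apply, h, CartanMatrix.B, of_apply, Fin.ext_iff, left_eq_add,
        one_ne_zero, if_false, if_true, w]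
      split_ifs <;> omega
    · by_cases h1 : (i : ℕ) + 1 = n
      · refine (hn.sum_mul_le_two hw i ⟨i - 1, by omega⟩ (by simp [Fin.ext_iff]; omega)).trans ?_
        have e : CartanMatrix.B n i ⟨i - 1, by omega⟩ = -1 := by
          simp only [CartanMatrix.B, of_apply, Fin.ext_iff]; split_ifs <;> omega
        simp only [submatrix_apply, h, e, Fin.ext_iff, w, show (i : ℕ) - 1 + 1 ≠ n by omega, h1,
          if_true, if_false]
        split_ifs <;> omega
      · refine (hn.sum_mul_le_three hw i ⟨i - 1, by omega⟩ ⟨i + 1, by omega⟩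
          (by simp [Fin.ext_iff]; omega) (by simp [Fin.ext_iff])
          (by simp [Fin.ext_iff])).trans ?_
        have e : CartanMatrix.B n i ⟨i - 1, by omega⟩ = -1 := by
          simp only [CartanMatrix.B, of_apply, Fin.ext_iff]; split_ifs <;> omega
        have e' : CartanMatrix.B n i ⟨i + 1, by omega⟩ =
            if (i : ℕ) + 1 + 1 = n then -2 else -1 := by
          simp only [CartanMatrix.B, of_apply, Fin.ext_iff]; split_ifs <;> omega
        simp only [submatrix_apply, h, e, e', Fin.ext_iff, w, show (i : ℕ) - 1 + 1 ≠ n by omega, h1,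
          if_false]
        split_ifs <;> omega
  have := hA.mul_mul_lt q hq w 2 hw (by rw [hwq]; split_ifs <;> omega)
    (fun i hi ↦ by simpa [hi] using key i) (by simpa using key q)
  rwa [hwq] at this

/-- The weight `min (j + 1) (q + 1)` is column `q` of the inverse, or twice that column if `q` is
the long root at the end; hence the two values of `c`. -/
lemma bound_C (hA : A.IsFiniteCartan) (hn : (A.submatrix some some).IsFiniteCartan) (q : Fin n)
    (h2 : 2 ≤ n) (h : ∀ i j, A (some i) (some j) = CartanMatrix.C n i j)
    (hq : ∀ j, j ≠ q → A none (some j) = 0) :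
    A none (some q) * A (some q) none * ((q : ℤ) + 1) < if (q : ℕ) + 1 = n then 4 else 2 := by
  have hqn := q.2
  let w (j : Fin n) : ℤ := min ((j : ℤ) + 1) (q + 1)
  have hw (i) : 0 ≤ w i := by simp only [w]; omega
  have hwq : w q = q + 1 := by simp [w]
  have key (i : Fin n) : ∑ j, A (some i) (some j) * w j ≤
      if i = q then (if (q : ℕ) + 1 = n then 2 else 1) else 0 := by
    have hi := i.2
    by_cases h0 : (i : ℕ) = 0
    · refine (hn.sum_mul_le_two hw i ⟨i + 1, by omega⟩ (by simp [Fin.ext_iff])).trans ?_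
      have e : CartanMatrix.C n i ⟨i + 1, by omega⟩ = -1 := by simp [CartanMatrix.C, Fin.ext_iff]
      simp only [submatrix_apply, h, e, Fin.ext_iff, w]
      split_ifs <;> omega
    · by_cases h1 : (i : ℕ) + 1 = n
      · refine (hn.sum_mul_le_two hw i ⟨i - 1, by omega⟩ (by simp [Fin.ext_iff]; omega)).trans ?_
        have e : CartanMatrix.C n i ⟨i - 1, by omega⟩ = -2 := by
          simp only [CartanMatrix.C, of_apply, Fin.ext_iff]; split_ifs <;> omega
        simp only [submatrix_apply, h, e, Fin.ext_iff, w]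
        split_ifs <;> omega
      · refine (hn.sum_mul_le_three hw i ⟨i - 1, by omega⟩ ⟨i + 1, by omega⟩
          (by simp [Fin.ext_iff]; omega) (by simp [Fin.ext_iff])
          (by simp [Fin.ext_iff])).trans ?_
        have e : CartanMatrix.C n i ⟨i - 1, by omega⟩ = -1 := by
          simp only [CartanMatrix.C, of_apply, Fin.ext_iff]; split_ifs <;> omega
        have e' : CartanMatrix.C n i ⟨i + 1, by omega⟩ = -1 := by
          simp [CartanMatrix.C, Fin.ext_iff]
        simp only [submatrix_apply, h, e, e', Fin.ext_iff, w]
        split_ifs <;> omega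
  have := hA.mul_mul_lt q hq w (if (q : ℕ) + 1 = n then 2 else 1) hw (by rw [hwq]; omega)
    (fun i hi ↦ by simpa [hi] using key i) (by simpa using key q)
  rw [hwq] at this
  split_ifs at * <;> omega

/-- Four times column `q` of the inverse serves as weight. Its shape depends on whether `q` lies on
the tail or is one of the two tips `n - 2`, `n - 1` of the fork. -/
lemma bound_D (hA : A.IsFiniteCartan) (hn : (A.submatrix some some).IsFiniteCartan) (q : Fin n)
    (h4 : 4 ≤ n) (h : ∀ i j, A (some i) (some j) = CartanMatrix.D n i j)
    (hq : ∀ j, j ≠ q → A none (some j) = 0) :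
    A none (some q) * A (some q) none *
      (if (q : ℕ) + 2 < n then 4 * ((q : ℤ) + 1) else (n : ℤ)) < 8 := by
  have hqn := q.2
  -- There are four kinds of rows: the free end of the tail, its interior, the branch vertex `n -
  -- 3`, and the two tips.
  have key (w : Fin n → ℤ) (hw : ∀ i, 0 ≤ w i)
      (h0 : ∀ hn, 2 * w ⟨0, by omega⟩ - w ⟨1, hn⟩ ≤ if (q : ℕ) = 0 then 4 else 0)
      (h1 : ∀ i (hi : i + 4 < n), 2 * w ⟨i + 1, by omega⟩ - w ⟨i, by omega⟩ - w ⟨i + 2, by omega⟩ ≤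
        if (q : ℕ) = i + 1 then 4 else 0)
      (h2 : 2 * w ⟨n - 3, by omega⟩ - w ⟨n - 4, by omega⟩ - w ⟨n - 2, by omega⟩ -
        w ⟨n - 1, by omega⟩ ≤ if (q : ℕ) = n - 3 then 4 else 0)
      (h3 : ∀ i (hi : i < n), n ≤ i + 2 →
        2 * w ⟨i, hi⟩ - w ⟨n - 3, by omega⟩ ≤ if (q : ℕ) = i then 4 else 0) (i : Fin n) :
      ∑ j, A (some i) (some j) * w j ≤ if i = q then 4 else 0 := by
    obtain ⟨i, hi⟩ := i
    by_cases c0 : i = 0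
    · refine (hn.sum_mul_le_two hw ⟨i, hi⟩ ⟨1, by omega⟩ (by simp [Fin.ext_iff, c0])).trans ?_
      subst c0
      refine le_trans (le_of_eq ?_) ((h0 (by omega)).trans (le_of_eq ?_))
      · simp only [submatrix_apply, h, CartanMatrix.D, of_apply, Fin.ext_iff]
        grind
      · simp only [Fin.ext_iff, eq_comm]
    by_cases c1 : i + 3 < n
    · obtain ⟨i, rfl⟩ := Nat.exists_eq_succ_of_ne_zero c0
      refine (hn.sum_mul_le_three hw ⟨i + 1, hi⟩ ⟨i, by omega⟩ ⟨i + 2, by omega⟩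
          (by simp [Fin.ext_iff]) (by simp [Fin.ext_iff])
          (by simp [Fin.ext_iff])).trans ?_
      refine le_trans (le_of_eq ?_) ((h1 i (by omega)).trans (le_of_eq ?_))
      · have e : CartanMatrix.D n ⟨i + 1, hi⟩ ⟨i, by omega⟩ = -1 := by
          simp only [CartanMatrix.D, of_apply, Fin.ext_iff]; grind
        have e' : CartanMatrix.D n ⟨i + 1, hi⟩ ⟨i + 2, by omega⟩ = -1 := by
          simp only [CartanMatrix.D, of_apply, Fin.ext_iff]; grind
        simp only [submatrix_apply, h, e, e']
        ring
      · simp only [Fin.ext_iff, eq_comm]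
    by_cases c2 : i + 3 = n
    · obtain rfl : i = n - 3 := by omega
      refine (hn.sum_mul_le_four hw ⟨n - 3, hi⟩ ⟨n - 4, by omega⟩ ⟨n - 2, by omega⟩
        ⟨n - 1, by omega⟩
          (by simp [Fin.ext_iff]; omega) (by simp [Fin.ext_iff]; omega)
          (by simp [Fin.ext_iff]; omega) (by simp [Fin.ext_iff]; omega)
          (by simp [Fin.ext_iff]; omega) (by simp [Fin.ext_iff]; omega)).trans ?_
      refine le_trans (le_of_eq ?_) (h2.trans (le_of_eq ?_))
      · have e : CartanMatrix.D n ⟨n - 3, hi⟩ ⟨n - 4, by omega⟩ = -1 := by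
          simp only [CartanMatrix.D, of_apply, Fin.ext_iff]; split_ifs <;> omega
        have e' : CartanMatrix.D n ⟨n - 3, hi⟩ ⟨n - 2, by omega⟩ = -1 := by
          simp only [CartanMatrix.D, of_apply, Fin.ext_iff]; split_ifs <;> omega
        have e'' : CartanMatrix.D n ⟨n - 3, hi⟩ ⟨n - 1, by omega⟩ = -1 := by
          simp only [CartanMatrix.D, of_apply, Fin.ext_iff]; split_ifs <;> omega
        simp only [submatrix_apply, h, e, e', e'']
        ring
      · simp only [Fin.ext_iff, eq_comm]
    · refine (hn.sum_mul_le_two hw ⟨i, hi⟩ ⟨n - 3, by omega⟩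
        (by simp [Fin.ext_iff]; omega)).trans ?_
      refine le_trans (le_of_eq ?_) ((h3 i hi (by omega)).trans (le_of_eq ?_))
      · have e : CartanMatrix.D n ⟨i, hi⟩ ⟨n - 3, by omega⟩ = -1 := by
          simp only [CartanMatrix.D, of_apply, Fin.ext_iff]; split_ifs <;> omega
        simp only [submatrix_apply, h, e]
        ring
      · simp only [Fin.ext_iff, eq_comm]
  have fin (w : Fin n → ℤ) (hw : ∀ i, 0 ≤ w i) (hwq : 0 < w q)
      (hk : ∀ i, ∑ j, A (some i) (some j) * w j ≤ if i = q then 4 else 0) :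
      A none (some q) * A (some q) none * w q < 8 :=
    hA.mul_mul_lt q hq w 4 hw hwq
      (fun i hi ↦ by simpa [hi] using hk i) (by simpa using hk q)
  by_cases hq2 : (q : ℕ) + 2 < n
  · let w (j : Fin n) : ℤ := if (j : ℕ) + 2 < n then 4 * min ((j : ℤ) + 1) (q + 1) else
      2 * ((q : ℤ) + 1)
    have hw (i) : 0 ≤ w i := by simp only [w]; split_ifs <;> omega
    have hwq : w q = 4 * ((q : ℤ) + 1) := by simp [w, hq2]
    rw [if_pos hq2, ← hwq]
    refine fin w hw (by rw [hwq]; omega) (key w hw ?_ ?_ ?_ ?_)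
    · intro; simp only [w]; split_ifs <;> omega
    · intro i hi
      simp only [w, show i + 2 < n by omega, show i + 1 + 2 < n by omega,
        show i + 2 + 2 < n by omega, if_true]
      split_ifs <;> omega
    · simp only [w, show n - 3 + 2 < n by omega, show n - 4 + 2 < n by omega,
        show ¬ n - 1 + 2 < n by omega, show ¬ n - 2 + 2 < n by omega, if_true, if_false]
      split_ifs <;> omega
    · intro i hi hi2
      simp only [w, show n - 3 + 2 < n by omega, show ¬ i + 2 < n by omega, if_true, if_false]
      split_ifs <;> omega
  · let w (j : Fin n) : ℤ := if (j : ℕ) + 2 < n then 2 * ((j : ℤ) + 1) else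
      if (j : ℕ) = q then n else n - 2
    have hw (i) : 0 ≤ w i := by simp only [w]; split_ifs <;> omega
    have hwq : w q = n := by simp [w, hq2]
    rw [if_neg hq2, ← hwq]
    refine fin w hw (by rw [hwq]; omega) (key w hw ?_ ?_ ?_ ?_)
    · intro; simp only [w]; split_ifs <;> omega
    · intro i hi
      simp only [w, show i + 2 < n by omega, show i + 1 + 2 < n by omega,
        show i + 2 + 2 < n by omega, if_true]
      split_ifs <;> omega
    · simp only [w, show n - 3 + 2 < n by omega, show n - 4 + 2 < n by omega,
        show ¬ n - 1 + 2 < n by omega, show ¬ n - 2 + 2 < n by omega, if_true, if_false]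
      split_ifs <;> omega
    · intro i hi hi2
      simp only [w, show n - 3 + 2 < n by omega, show ¬ i + 2 < n by omega, if_true, if_false]
      split_ifs <;> omega

end IsFiniteCartan

end Matrix

/-! ### Attaching a vertex to each type, and the classification -/

namespace Matrix

namespace IsFiniteCartan

variable {n : ℕ} {A : Matrix (Option (Fin n)) (Option (Fin n)) ℤ}

/-- For a fixed matrix `M` the columns of `W = c M⁻¹` are the weights, and the hypotheses can be
checked by evaluation. -/
lemma bound_of_mul_eq (hA : A.IsFiniteCartan) (q : Fin n)
    (hq : ∀ j, j ≠ q → A none (some j) = 0) (M W : Matrix (Fin n) (Fin n) ℤ)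
    (h : ∀ i j, A (some i) (some j) = M i j) (c : ℤ)
    (hW : ∀ i j, decide (0 < W i j) = true) (hM : M * W = c • 1) :
    A none (some q) * A (some q) none * W q q < 2 * c := by
  have e (i : Fin n) : ∑ j, A (some i) (some j) * W j q = if i = q then c else 0 := by
    have := congr_fun₂ hM i q
    simp only [mul_apply, smul_apply, one_apply, smul_eq_mul, mul_ite, mul_one, mul_zero] at this
    simpa only [h] using this
  exact hA.mul_mul_lt q hq (fun j ↦ W j q) c (fun i ↦ (of_decide_eq_true (hW i q)).le)
    (of_decide_eq_true (hW q q))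
    (fun i hi ↦ by simp [e i, hi]) (by simp [e q])

/-- A variant of `isOfType_of_bijective` whose hypotheses can be decided. -/
lemma isOfType_of_decide (hA : A.IsFiniteCartan) (q : Fin n) {M : Matrix (Fin n) (Fin n) ℤ}
    {a b : ℤ} (h : ∀ i j, A (some i) (some j) = M i j) (hq : ∀ j, j ≠ q → A none (some j) = 0)
    (ha : A none (some q) = a) (hb : A (some q) none = b) (T : SimpleType)
    (f : Option (Fin n) → Fin T.rank) (hf : f.Bijective)
    (h1 : ∀ i j, decide (M i j = T.cartan (f (some i)) (f (some j))) = true)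
    (h0 : decide (T.cartan (f none) (f none) = 2 ∧ T.cartan (f none) (f (some q)) = a ∧
      T.cartan (f (some q)) (f none) = b) = true)
    (h4 : ∀ j, decide (j ≠ q → T.cartan (f none) (f (some j)) = 0 ∧
      T.cartan (f (some j)) (f none) = 0) = true) :
    A.IsOfType T := by
  simp only [decide_eq_true_eq] at h1 h0 h4
  exact hA.isOfType_of_bijective q hq T f hf (fun i j ↦ (h i j).trans (h1 i j)) h0.1
    (h0.2.1.trans ha.symm) (h0.2.2.trans hb.symm) h4

/-- With `q` in the right half of the chain, let `m = n - q` count the vertices from `q` to the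
right end. At `m = 1` the chain is prolonged, giving A, B, C, or G₂ when `n = 1`; `m = 2` gives D
and `m = 3` gives E₆, E₇, E₈. If `m ≥ 4` then `(q + 1) m ≥ 4 (q + 1) ≥ 2 (q + 1 + m) = 2 (n + 1)`,
against `bound_A`. -/
lemma exists_isOfType_A_of_le (hA : A.IsFiniteCartan) (hn : (A.submatrix some some).IsFiniteCartan)
    (q : Fin n) (h : ∀ i j, A (some i) (some j) = CartanMatrix.A n i j)
    (hq0 : A none (some q) ≠ 0) (hq : ∀ j, j ≠ q → A none (some j) = 0)
    (hle : n - (q : ℕ) ≤ q + 1) : ∃ T, A.IsOfType T := by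
  have hqn := q.2
  have key := hA.bound_A hn q h hq
  have bond := hA.bond q hq0 hq
  obtain hm | hm | hm | hm : n - (q : ℕ) = 1 ∨ n - (q : ℕ) = 2 ∨ n - (q : ℕ) = 3 ∨
      4 ≤ n - (q : ℕ) := by lia
  · have e : (q : ℕ) = n - 1 := by lia
    obtain ⟨b1, b2⟩ | ⟨b1, b2⟩ | ⟨b1, b2⟩ | ⟨b1, b2⟩ | ⟨b1, b2⟩ := bond
    · refine ⟨.A (n + 1) (by lia), hA.isOfType_of_bijective q hq _ (snoc n) (snoc_bijective n)
        ?_ ?_ ?_ ?_ ?_⟩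
      all_goals simp [h, b1, b2, SimpleType.cartan, snoc, CartanMatrix.A, Fin.ext_iff]
      all_goals grind
    · refine ⟨.B (n + 1) (by lia), hA.isOfType_of_bijective q hq _ (snoc n) (snoc_bijective n)
        ?_ ?_ ?_ ?_ ?_⟩
      all_goals simp [h, b1, b2, SimpleType.cartan, snoc, CartanMatrix.A, CartanMatrix.B,
        Fin.ext_iff]
      all_goals grind
    · refine ⟨.C (n + 1) (by lia), hA.isOfType_of_bijective q hq _ (snoc n) (snoc_bijective n)
        ?_ ?_ ?_ ?_ ?_⟩
      all_goals simp [h, b1, b2, SimpleType.cartan, snoc, CartanMatrix.A, CartanMatrix.C,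
        Fin.ext_iff]
      all_goals grind
    · rw [b1, b2, show (n : ℤ) - q = 1 by lia] at key
      obtain rfl : n = 1 := by lia
      obtain rfl : q = 0 := Subsingleton.elim _ _
      exact ⟨.G₂, hA.isOfType_of_decide 0 h hq b1 b2 _
        (fun o ↦ o.elim (1 : Fin 2) fun _ ↦ (0 : Fin 2))
        (by decide) (by decide) (by decide) (by decide)⟩
    · rw [b1, b2, show (n : ℤ) - q = 1 by lia] at key
      obtain rfl : n = 1 := by lia
      obtain rfl : q = 0 := Subsingleton.elim _ _
      exact ⟨.G₂, hA.isOfType_of_decide 0 h hq b1 b2 _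
        (fun o ↦ o.elim (0 : Fin 2) fun _ ↦ (1 : Fin 2))
        (by decide) (by decide) (by decide) (by decide)⟩
  · have e : (q : ℕ) + 2 = n := by lia
    rw [show (n : ℤ) - q = 2 by lia] at key
    obtain ⟨b1, b2⟩ | ⟨b1, b2⟩ | ⟨b1, b2⟩ | ⟨b1, b2⟩ | ⟨b1, b2⟩ := bond
    · refine ⟨.D (n + 1) (by lia), hA.isOfType_of_bijective q hq _ (snoc n) (snoc_bijective n)
        ?_ ?_ ?_ ?_ ?_⟩
      all_goals simp [h, b1, b2, SimpleType.cartan, snoc, CartanMatrix.A, CartanMatrix.D,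
        Fin.ext_iff]
      all_goals grind
    all_goals rw [b1, b2] at key; lia
  · have e : (q : ℕ) + 3 = n := by lia
    rw [show (n : ℤ) - q = 3 by lia] at key
    obtain ⟨b1, b2⟩ | ⟨b1, b2⟩ | ⟨b1, b2⟩ | ⟨b1, b2⟩ | ⟨b1, b2⟩ := bond
    · rw [b1, b2] at key
      obtain h5 | h5 | h5 : n = 5 ∨ n = 6 ∨ n = 7 := by lia
      · subst h5
        obtain rfl : q = 2 := by ext; lia
        exact ⟨.E₆, hA.isOfType_of_decide 2 h hq b1 b2 _
          (fun o ↦ o.elim (1 : Fin 6) (![0, 2, 3, 4, 5] : Fin 5 → Fin 6))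
          (by decide) (by decide) (by decide) (by decide)⟩
      · subst h5
        obtain rfl : q = 3 := by ext; lia
        exact ⟨.E₇, hA.isOfType_of_decide 3 h hq b1 b2 _
          (fun o ↦ o.elim (1 : Fin 7) (![6, 5, 4, 3, 2, 0] : Fin 6 → Fin 7))
          (by decide) (by decide) (by decide) (by decide)⟩
      · subst h5
        obtain rfl : q = 4 := by ext; lia
        exact ⟨.E₈, hA.isOfType_of_decide 4 h hq b1 b2 _
          (fun o ↦ o.elim (1 : Fin 8) (![7, 6, 5, 4, 3, 2, 0] : Fin 7 → Fin 8))
          (by decide) (by decide) (by decide) (by decide)⟩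
    all_goals rw [b1, b2] at key; lia
  · exfalso
    have hab : 1 ≤ A none (some q) * A (some q) none := by
      obtain ⟨b1, b2⟩ | ⟨b1, b2⟩ | ⟨b1, b2⟩ | ⟨b1, b2⟩ | ⟨b1, b2⟩ := bond <;> simp [b1, b2]
    have h1 : (4 : ℤ) ≤ n - q := by lia
    have h2 : (n : ℤ) - q ≤ q + 1 := by lia
    nlinarith [mul_le_mul_of_nonneg_right hab (show 0 ≤ ((q : ℤ) + 1) * (n - q) by positivity)]

/-- Reversing the chain puts `q` in the right half. -/
lemma exists_isOfType_A (hA : A.IsFiniteCartan) (hn : (A.submatrix some some).IsFiniteCartan)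
    (q : Fin n) (h : ∀ i j, A (some i) (some j) = CartanMatrix.A n i j)
    (hq0 : A none (some q) ≠ 0) (hq : ∀ j, j ≠ q → A none (some j) = 0) :
    ∃ T, A.IsOfType T := by
  by_cases hle : n - (q : ℕ) ≤ q + 1
  · exact hA.exists_isOfType_A_of_le hn q h hq0 hq hle
  · let e : Option (Fin n) ≃ Option (Fin n) := Fin.revPerm.optionCongr
    have := (hA.reindex e).exists_isOfType_A_of_le
      (hn.reindex Fin.revPerm) (Fin.rev q) (fun i j ↦ ?_)
      (by simpa [e] using hq0) (fun j hj ↦ by simpa [e] using hq j.rev (by grind))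
      (by simp only [Fin.val_rev]; lia)
    · obtain ⟨T, hT⟩ := this
      exact ⟨T, hT.of_submatrix e⟩
    · simp [e, h, CartanMatrix.A]
      grind

/-- At the short end the bound leaves `n = 2`, where B₂ read backwards is C₂ and grows to C₃, and `n
= 3`, which gives F₄. Elsewhere only a simple bond at the first vertex survives. -/
lemma exists_isOfType_B (hA : A.IsFiniteCartan) (hn : (A.submatrix some some).IsFiniteCartan)
    (q : Fin n) (h2 : 2 ≤ n) (h : ∀ i j, A (some i) (some j) = CartanMatrix.B n i j)
    (hq0 : A none (some q) ≠ 0) (hq : ∀ j, j ≠ q → A none (some j) = 0) :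
    ∃ T, A.IsOfType T := by
  have hqn := q.2
  have key := hA.bound_B hn q h2 h hq
  have bond := hA.bond q hq0 hq
  split_ifs at key with h1
  · obtain ⟨b1, b2⟩ | ⟨b1, b2⟩ | ⟨b1, b2⟩ | ⟨b1, b2⟩ | ⟨b1, b2⟩ := bond
    · rw [b1, b2] at key
      obtain h5 | h5 : n = 2 ∨ n = 3 := by lia
      · subst h5
        obtain rfl : q = 1 := by ext; lia
        exact ⟨.C 3 (by lia), hA.isOfType_of_decide 1 h hq b1 b2 _
          (fun o ↦ o.elim (0 : Fin 3) (![2, 1] : Fin 2 → Fin 3))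
          (by decide) (by decide) (by decide) (by decide)⟩
      · subst h5
        obtain rfl : q = 2 := by ext; lia
        exact ⟨.F₄, hA.isOfType_of_decide 2 h hq b1 b2 _
          (fun o ↦ o.elim (3 : Fin 4) (![0, 1, 2] : Fin 3 → Fin 4))
          (by decide) (by decide) (by decide) (by decide)⟩
    all_goals rw [b1, b2] at key; lia
  · obtain ⟨b1, b2⟩ | ⟨b1, b2⟩ | ⟨b1, b2⟩ | ⟨b1, b2⟩ | ⟨b1, b2⟩ := bond
    · rw [b1, b2] at key
      have e : (q : ℕ) = 0 := by lia
      refine ⟨.B (n + 1) (by lia), hA.isOfType_of_bijective q hq _ (cons n) (cons_bijective n)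
        ?_ ?_ ?_ ?_ ?_⟩
      all_goals simp [h, b1, b2, SimpleType.cartan, cons, CartanMatrix.B,
        Fin.ext_iff]
      all_goals grind
    all_goals rw [b1, b2] at key; lia

/-- The situation is dual to type B: the long end allows only B₃ and F₄, the rest of the chain only
a simple bond at the first vertex. -/
lemma exists_isOfType_C (hA : A.IsFiniteCartan) (hn : (A.submatrix some some).IsFiniteCartan)
    (q : Fin n) (h2 : 2 ≤ n) (h : ∀ i j, A (some i) (some j) = CartanMatrix.C n i j)
    (hq0 : A none (some q) ≠ 0) (hq : ∀ j, j ≠ q → A none (some j) = 0) :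
    ∃ T, A.IsOfType T := by
  have hqn := q.2
  have key := hA.bound_C hn q h2 h hq
  have bond := hA.bond q hq0 hq
  split_ifs at key with h1
  · obtain ⟨b1, b2⟩ | ⟨b1, b2⟩ | ⟨b1, b2⟩ | ⟨b1, b2⟩ | ⟨b1, b2⟩ := bond
    · rw [b1, b2] at key
      obtain h5 | h5 : n = 2 ∨ n = 3 := by lia
      · subst h5
        obtain rfl : q = 1 := by ext; lia
        exact ⟨.B 3 (by lia), hA.isOfType_of_decide 1 h hq b1 b2 _
          (fun o ↦ o.elim (0 : Fin 3) (![2, 1] : Fin 2 → Fin 3))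
          (by decide) (by decide) (by decide) (by decide)⟩
      · subst h5
        obtain rfl : q = 2 := by ext; lia
        exact ⟨.F₄, hA.isOfType_of_decide 2 h hq b1 b2 _
          (fun o ↦ o.elim (0 : Fin 4) (![3, 2, 1] : Fin 3 → Fin 4))
          (by decide) (by decide) (by decide) (by decide)⟩
    all_goals rw [b1, b2] at key; lia
  · obtain ⟨b1, b2⟩ | ⟨b1, b2⟩ | ⟨b1, b2⟩ | ⟨b1, b2⟩ | ⟨b1, b2⟩ := bond
    · rw [b1, b2] at key
      have e : (q : ℕ) = 0 := by lia
      refine ⟨.C (n + 1) (by lia), hA.isOfType_of_bijective q hq _ (cons n) (cons_bijective n)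
        ?_ ?_ ?_ ?_ ?_⟩
      all_goals simp [h, b1, b2, SimpleType.cartan, cons, CartanMatrix.C,
        Fin.ext_iff]
      all_goals grind
    all_goals rw [b1, b2] at key; lia

/-- On the tail only the first vertex is possible. At a tip of the fork `n < 8`: D₄ gives D₅ by the
symmetry of its three arms, and D₅, D₆, D₇ give E₆, E₇, E₈. -/
lemma exists_isOfType_D (hA : A.IsFiniteCartan) (hn : (A.submatrix some some).IsFiniteCartan)
    (q : Fin n) (h4 : 4 ≤ n) (h : ∀ i j, A (some i) (some j) = CartanMatrix.D n i j)
    (hq0 : A none (some q) ≠ 0) (hq : ∀ j, j ≠ q → A none (some j) = 0) :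
    ∃ T, A.IsOfType T := by
  have hqn := q.2
  have key := hA.bound_D hn q h4 h hq
  have bond := hA.bond q hq0 hq
  split_ifs at key with h1
  · obtain ⟨b1, b2⟩ | ⟨b1, b2⟩ | ⟨b1, b2⟩ | ⟨b1, b2⟩ | ⟨b1, b2⟩ := bond
    · rw [b1, b2] at key
      have e : (q : ℕ) = 0 := by lia
      refine ⟨.D (n + 1) (by lia), hA.isOfType_of_bijective q hq _ (cons n) (cons_bijective n)
        ?_ ?_ ?_ ?_ ?_⟩
      all_goals simp [h, b1, b2, SimpleType.cartan, cons, CartanMatrix.D,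
        Fin.ext_iff]
      all_goals grind
    all_goals rw [b1, b2] at key; lia
  · obtain ⟨b1, b2⟩ | ⟨b1, b2⟩ | ⟨b1, b2⟩ | ⟨b1, b2⟩ | ⟨b1, b2⟩ := bond
    · rw [b1, b2] at key
      obtain h5 | h5 | h5 | h5 : n = 4 ∨ n = 5 ∨ n = 6 ∨ n = 7 := by lia
      · subst h5
        obtain rfl | rfl : q = 2 ∨ q = 3 := by grind
        · exact ⟨.D 5 (by lia), hA.isOfType_of_decide 2 h hq b1 b2 _
            (fun o ↦ o.elim (0 : Fin 5) (![3, 2, 1, 4] : Fin 4 → Fin 5))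
            (by decide) (by decide) (by decide) (by decide)⟩
        · exact ⟨.D 5 (by lia), hA.isOfType_of_decide 3 h hq b1 b2 _
            (fun o ↦ o.elim (0 : Fin 5) (![3, 2, 4, 1] : Fin 4 → Fin 5))
            (by decide) (by decide) (by decide) (by decide)⟩
      · subst h5
        obtain rfl | rfl : q = 3 ∨ q = 4 := by grind
        · exact ⟨.E₆, hA.isOfType_of_decide 3 h hq b1 b2 _
            (fun o ↦ o.elim (0 : Fin 6) (![5, 4, 3, 2, 1] : Fin 5 → Fin 6))
            (by decide) (by decide) (by decide) (by decide)⟩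
        · exact ⟨.E₆, hA.isOfType_of_decide 4 h hq b1 b2 _
            (fun o ↦ o.elim (0 : Fin 6) (![5, 4, 3, 1, 2] : Fin 5 → Fin 6))
            (by decide) (by decide) (by decide) (by decide)⟩
      · subst h5
        obtain rfl | rfl : q = 4 ∨ q = 5 := by grind
        · exact ⟨.E₇, hA.isOfType_of_decide 4 h hq b1 b2 _
            (fun o ↦ o.elim (0 : Fin 7) (![6, 5, 4, 3, 2, 1] : Fin 6 → Fin 7))
            (by decide) (by decide) (by decide) (by decide)⟩
        · exact ⟨.E₇, hA.isOfType_of_decide 5 h hq b1 b2 _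
            (fun o ↦ o.elim (0 : Fin 7) (![6, 5, 4, 3, 1, 2] : Fin 6 → Fin 7))
            (by decide) (by decide) (by decide) (by decide)⟩
      · subst h5
        obtain rfl | rfl : q = 5 ∨ q = 6 := by grind
        · exact ⟨.E₈, hA.isOfType_of_decide 5 h hq b1 b2 _
            (fun o ↦ o.elim (0 : Fin 8) (![7, 6, 5, 4, 3, 2, 1] : Fin 7 → Fin 8))
            (by decide) (by decide) (by decide) (by decide)⟩
        · exact ⟨.E₈, hA.isOfType_of_decide 6 h hq b1 b2 _
            (fun o ↦ o.elim (0 : Fin 8) (![7, 6, 5, 4, 3, 1, 2] : Fin 7 → Fin 8))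
            (by decide) (by decide) (by decide) (by decide)⟩
    all_goals rw [b1, b2] at key; lia

lemma one_le_bond (hA : A.IsFiniteCartan) (q : Fin n)
    (hq0 : A none (some q) ≠ 0) (hq : ∀ j, j ≠ q → A none (some j) = 0) :
    1 ≤ A none (some q) * A (some q) none := by
  obtain ⟨b1, b2⟩ | ⟨b1, b2⟩ | ⟨b1, b2⟩ | ⟨b1, b2⟩ | ⟨b1, b2⟩ := hA.bond q hq0 hq <;>
    simp [b1, b2]

/-- This rules out extensions of G₂, F₄ and E₈: their Cartan matrices have integral inverses with
all diagonal entries at least 2. -/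
lemma not_extend (hA : A.IsFiniteCartan) (q : Fin n)
    (hq0 : A none (some q) ≠ 0) (hq : ∀ j, j ≠ q → A none (some j) = 0)
    (M W : Matrix (Fin n) (Fin n) ℤ) (h : ∀ i j, A (some i) (some j) = M i j)
    (hW : ∀ i j, decide (0 < W i j) = true) (hWd : ∀ i, decide (2 ≤ W i i) = true)
    (hM : M * W = (1 : ℤ) • 1) : False := by
  have := hA.bound_of_mul_eq q hq M W h 1 hW hM
  nlinarith [hA.one_le_bond q hq0 hq, of_decide_eq_true (hWd q)]

lemma exists_isOfType_E₆ {A : Matrix (Option (Fin 6)) (Option (Fin 6)) ℤ} (hA : A.IsFiniteCartan)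
    (q : Fin 6) (h : ∀ i j, A (some i) (some j) = CartanMatrix.E₆ i j)
    (hq0 : A none (some q) ≠ 0) (hq : ∀ j, j ≠ q → A none (some j) = 0) :
    ∃ T, A.IsOfType T := by
  -- Three times the inverse of the Cartan matrix. Only the ends 0 and 5 of the long arms have a
  -- diagonal entry below `2 * 3`.
  have key := hA.bound_of_mul_eq q hq _ !![4, 3, 5, 6, 4, 2;
    3, 6, 6, 9, 6, 3;
    5, 6, 10, 12, 8, 4;
    6, 9, 12, 18, 12, 6;
    4, 6, 8, 12, 10, 5;
    2, 3, 4, 6, 5, 4] h 3 (by decide) (by decide)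
  obtain ⟨b1, b2⟩ | ⟨b1, b2⟩ | ⟨b1, b2⟩ | ⟨b1, b2⟩ | ⟨b1, b2⟩ := hA.bond q hq0 hq
  · rw [b1, b2] at key
    obtain rfl | rfl : q = 0 ∨ q = 5 := by
      revert key; clear * -; revert q; decide
    · exact ⟨.E₇, hA.isOfType_of_decide 0 h hq b1 b2 _
        (fun o ↦ o.elim (6 : Fin 7) (![5, 1, 4, 3, 2, 0] : Fin 6 → Fin 7))
        (by decide) (by decide) (by decide) (by decide)⟩
    · exact ⟨.E₇, hA.isOfType_of_decide 5 h hq b1 b2 _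
        (fun o ↦ o.elim (6 : Fin 7) (![0, 1, 2, 3, 4, 5] : Fin 6 → Fin 7))
        (by decide) (by decide) (by decide) (by decide)⟩
  all_goals
    exfalso
    rw [b1, b2] at key
    revert key; clear * -; revert q; decide

lemma exists_isOfType_E₇ {A : Matrix (Option (Fin 7)) (Option (Fin 7)) ℤ} (hA : A.IsFiniteCartan)
    (q : Fin 7) (h : ∀ i j, A (some i) (some j) = CartanMatrix.E₇ i j)
    (hq0 : A none (some q) ≠ 0) (hq : ∀ j, j ≠ q → A none (some j) = 0) :
    ∃ T, A.IsOfType T := by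
  -- Twice the inverse of the Cartan matrix. Only vertex 6 has a diagonal entry below `2 * 2`.
  have key := hA.bound_of_mul_eq q hq _ !![4, 4, 6, 8, 6, 4, 2;
    4, 7, 8, 12, 9, 6, 3;
    6, 8, 12, 16, 12, 8, 4;
    8, 12, 16, 24, 18, 12, 6;
    6, 9, 12, 18, 15, 10, 5;
    4, 6, 8, 12, 10, 8, 4;
    2, 3, 4, 6, 5, 4, 3] h 2 (by decide) (by decide)
  obtain ⟨b1, b2⟩ | ⟨b1, b2⟩ | ⟨b1, b2⟩ | ⟨b1, b2⟩ | ⟨b1, b2⟩ := hA.bond q hq0 hq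
  · rw [b1, b2] at key
    obtain rfl : q = 6 := by
      revert key; clear * -; revert q; decide
    exact ⟨.E₈, hA.isOfType_of_decide 6 h hq b1 b2 _
        (fun o ↦ o.elim (7 : Fin 8) (![0, 1, 2, 3, 4, 5, 6] : Fin 7 → Fin 8))
        (by decide) (by decide) (by decide) (by decide)⟩
  all_goals
    exfalso
    rw [b1, b2] at key
    revert key; clear * -; revert q; decide

/-- In D₃ vertex 0 is joined to 1 and 2, so exchanging 0 and 1 turns it into the chain A₃. -/
lemma exists_isOfType_D₃ {A : Matrix (Option (Fin 3)) (Option (Fin 3)) ℤ} (hA : A.IsFiniteCartan)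
    (hn : (A.submatrix some some).IsFiniteCartan)
    (q : Fin 3) (h : ∀ i j, A (some i) (some j) = CartanMatrix.D 3 i j)
    (hq0 : A none (some q) ≠ 0) (hq : ∀ j, j ≠ q → A none (some j) = 0) :
    ∃ T, A.IsOfType T := by
  let e : Equiv.Perm (Fin 3) := Equiv.swap 0 1
  have he : ∀ i j, decide (CartanMatrix.D 3 (Equiv.swap 0 1 i) (Equiv.swap 0 1 j) =
    CartanMatrix.A 3 i j) = true := by decide
  obtain ⟨T, hT⟩ := exists_isOfType_A (hA.reindex e.optionCongr) (hn.reindex e) (e.symm q)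
    (fun i j ↦ (h _ _).trans (of_decide_eq_true (he i j)))
    (by simpa using hq0)
    (fun j hj ↦ hq (e j) (fun h ↦ hj (by rw [← h, Equiv.symm_apply_apply])))
  exact ⟨T, hT.of_submatrix e.optionCongr⟩

lemma exists_isOfType_option (T : SimpleType)
    {A : Matrix (Option (Fin T.rank)) (Option (Fin T.rank)) ℤ}
    (hA : A.IsFiniteCartan) (hn : (A.submatrix some some).IsFiniteCartan)
    (q : Fin T.rank) (h : ∀ i j, A (some i) (some j) = T.cartan i j)
    (hq0 : A none (some q) ≠ 0) (hq : ∀ j, j ≠ q → A none (some j) = 0) :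
    ∃ T, A.IsOfType T := by
  cases T with
  | A n _ => exact exists_isOfType_A hA hn q h hq0 hq
  | B n h2 => exact exists_isOfType_B hA hn q h2 h hq0 hq
  | C n h2 => exact exists_isOfType_C hA hn q h2 h hq0 hq
  | D n h3 =>
    obtain rfl | h4 := h3.eq_or_lt
    · exact exists_isOfType_D₃ hA hn q h hq0 hq
    · exact exists_isOfType_D hA hn q h4 h hq0 hq
  | G₂ =>
    exact (not_extend hA q hq0 hq _ !![2, 3; 1, 2] h (by decide) (by decide) (by decide)).elim
  | F₄ =>
    exact (not_extend hA q hq0 hq _ !![2, 3, 4, 2;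
      3, 6, 8, 4;
      2, 4, 6, 3;
      1, 2, 3, 2] h (by decide) (by decide) (by decide)).elim
  | E₆ => exact exists_isOfType_E₆ hA q h hq0 hq
  | E₇ => exact exists_isOfType_E₇ hA q h hq0 hq
  | E₈ =>
    exact (not_extend hA q hq0 hq _ !![4, 5, 7, 10, 8, 6, 4, 2;
      5, 8, 10, 15, 12, 9, 6, 3;
      7, 10, 14, 20, 16, 12, 8, 4;
      10, 15, 20, 30, 24, 18, 12, 6;
      8, 12, 16, 24, 20, 15, 10, 5;
      6, 9, 12, 18, 15, 12, 8, 4;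
      4, 6, 8, 12, 10, 8, 6, 3;
      2, 3, 4, 6, 5, 4, 3, 2] h (by decide) (by decide) (by decide)).elim

end IsFiniteCartan

/-- The classification of Cartan matrices of finite type. -/
theorem IsFiniteCartan.exists_isOfType {I : Type*} [Fintype I] [Nonempty I] {A : Matrix I I ℤ}
    (hA : A.IsFiniteCartan) : ∃ T, A.IsOfType T := by
  classical
  generalize hc : Fintype.card I = n
  induction n generalizing I with
  | zero => simp at hc
  | succ n ih =>
    obtain ⟨p, hp⟩ := hA.exists_leaf
    let e := Equiv.optionSubtypeNe p
    have hB := hA.reindex e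
    have hn := hB.of_option fun q q' h h' ↦ Subtype.ext <| hp q q' q.2 q'.2
      (by simpa [e] using h) (by simpa [e] using h')
    have hcard : Fintype.card {i // i ≠ p} = n := by
      have := Fintype.card_congr e
      simp only [Fintype.card_option] at this
      lia
    by_cases hn0 : Nonempty {i // i ≠ p}
    · obtain ⟨T, f, hf⟩ := ih hn hcard
      let A' := (A.submatrix e e).submatrix f.symm.optionCongr f.symm.optionCongr
      have hA1 (j) : A' none (some j) = A p (f.symm j) := rfl
      have hA2 (i j) : A' (some i) (some j) = A (f.symm i) (f.symm j) := rfl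
      have hA' : A'.IsFiniteCartan := hB.reindex f.symm.optionCongr
      obtain ⟨q, hq⟩ : ∃ q, A' none (some q) ≠ 0 := by
        -- Without a neighbour of the removed vertex, the remaining vertices would be closed under
        -- adjacency, against connectedness.
        by_contra! h
        have := hA'.connected (fun o ↦ o ≠ none) (i := some (f hn0.some)) (j := none) (by simp) ?_
        · exact this rfl
        · rintro (_ | i) (_ | j) h1 h2
          · exact h1
          · simp
          · exact (h2 (h i)).elim
          · simp
      have hq' (j) (hj : j ≠ q) : A' none (some j) = 0 := by
        by_contra h
        refine hj (f.symm.injective (Subtype.ext ?_))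
        exact hp _ _ (f.symm j).2 (f.symm q).2 (by rwa [← hA1]) (by rwa [← hA1])
      obtain ⟨T', hT'⟩ := exists_isOfType_option T hA' (hn.reindex f.symm) q
        (fun i j ↦ by simpa [e, hA2] using hf (f.symm i) (f.symm j)) hq hq'
      exact ⟨T', (hT'.of_submatrix _).of_submatrix _⟩
    · have hp' (i : I) : i = p := by
        by_contra h
        exact hn0 ⟨i, h⟩
      have : Unique I := ⟨⟨p⟩, hp'⟩
      refine ⟨.A 1 le_rfl, Equiv.ofUnique _ (Fin 1), fun i j ↦ ?_⟩
      rw [Subsingleton.elim j i, hA.diag]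
      exact (congr_fun (CartanMatrix.A_diag 1) _).symm

end Matrix

/-! ### The Cartan matrix and the Weyl vector of a root system -/

namespace RootPairing.Base

variable {ι K M N : Type*} [Field K] [CharZero K] [AddCommGroup M] [Module K M]
  [AddCommGroup N] [Module K N] [Finite ι] {P : RootPairing ι K M N} [P.IsRootSystem]
  [P.IsCrystallographic] [P.IsReduced] [P.IsIrreducible] (b : P.Base)

lemma isFiniteCartan_cartanMatrix : b.cartanMatrix.IsFiniteCartan where
  diag := b.cartanMatrix_apply_same
  nonpos h := b.cartanMatrix_le_zero_of_ne _ _ h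
  eq_zero h := b.cartanMatrix_apply_eq_zero_iff_symm.mp h
  posDef := by
    classical
    obtain ⟨d, hd, hp⟩ := b.exists_cartanMatrix_diagaonal_mul_posDef
    refine ⟨d, hd, fun i j ↦ ?_, fun x hx ↦ ?_⟩
    · have := hp.isHermitian.apply j i
      simpa [Matrix.diagonal_mul] using this
    · have := hp.2 (x := Finsupp.equivFunOnFinite.symm x) (fun h ↦ hx <| by
        ext i; simpa using DFunLike.congr_fun h i)
      rw [Finsupp.sum_fintype _ _ (by simp)] at this
      refine this.trans_eq (Finset.sum_congr rfl fun i _ ↦ ?_)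
      rw [Finsupp.sum_fintype _ _ (by simp), Finset.mul_sum]
      refine Finset.sum_congr rfl fun j _ ↦ ?_
      rw [Matrix.diagonal_mul]
      simp only [Finsupp.equivFunOnFinite_symm_apply_apply, star_trivial]
      ring
  connected p _ _ hi hp := b.induction_on_cartanMatrix p hi hp

/-- The Cartan–Killing classification. -/
theorem exists_hasType [Nonempty ι] : ∃ T, b.HasType T :=
  have : Nonempty b.support := b.support_nonempty.to_subtype
  b.isFiniteCartan_cartanMatrix.exists_isOfType

end RootPairing.Base

namespace RootPairing.Base

variable {ι K M N : Type*} [Fintype ι] [Field K] [CharZero K] [AddCommGroup M] [Module K M]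
  [AddCommGroup N] [Module K N] {P : RootPairing ι K M N}
  [P.IsCrystallographic] [P.IsReduced] (b : P.Base)

open Classical in
/-- The pairing of the Weyl vector with a simple coroot is one. -/
lemma coroot'_weylVector {j : ι} (hj : j ∈ b.support) : P.coroot' j b.weylVector = 1 := by
  have h0 : ∑ i with b.IsPos i ∧ i ≠ j, P.pairing i j = 0 := by
    -- The simple reflection at `j` permutes the positive roots other than `αⱼ` and negates their
    -- pairing with `αⱼ^∨`; a root it fixes has pairing zero.
    refine Finset.sum_involution (fun i _ ↦ P.reflectionPerm j i) ?_ ?_ ?_ ?_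
    · intro i _
      rw [← P.pairing_reflectionPerm, P.pairing_reflectionPerm_self_right]
      simp
    · intro i _ hi h
      have h2 := P.pairing_reflectionPerm j i j
      rw [h, P.pairing_reflectionPerm_self_right] at h2
      exact hi (by linear_combination (-1 / 2 : K) * h2)
    · intro i hi
      simp only [Finset.mem_filter, Finset.mem_univ, true_and] at hi ⊢
      refine ⟨hi.1.reflectionPerm hj hi.2, fun h ↦ ?_⟩
      have h1 : i = P.reflectionPerm j j := by
        rw [← P.reflectionPerm_self j i, h]
      have h2 : b.height (P.reflectionPerm j j) = -b.height j := b.height_reflectionPerm_self j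
      have h3 := hi.1
      rw [h1, b.isPos_iff, h2, b.height_one_of_mem_support hj] at h3
      lia
    · simp
  have h1 : ∑ i with b.IsPos i, P.pairing i j = 2 := by
    rw [← Finset.add_sum_erase _ _ (a := j) (by simpa using b.isPos_of_mem_support hj),
      P.pairing_same, add_eq_left, ← h0]
    refine Finset.sum_congr ?_ fun _ _ ↦ rfl
    ext; simp [and_comm]
  rw [weylVector, map_smul, map_sum]
  simp only [P.root_coroot'_eq_pairing, h1]
  simp

end RootPairing.Base

/-! ### Models of the positive roots and their comparison with a root system -/

/-- A combinatorial model of the positive roots of a root system with Cartan matrix `C`. -/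
structure RootModel {n : ℕ} (C : Matrix (Fin n) (Fin n) ℤ) (V X : Type*) [AddCommGroup V] where
  /-- the simple roots -/
  simple : Fin n → V
  /-- the pairings with the simple coroots -/
  coroot : Fin n → V →+ ℤ
  coroot_simple (i j : Fin n) : coroot j (simple i) = C i j
  /-- half the squared lengths of the simple roots, up to a common factor -/
  len : Fin n → ℤ
  len_pos (i : Fin n) : 0 < len i
  len_symm (i j : Fin n) : C i j * len j = C j i * len i
  /-- the pairing with the Weyl vector -/
  rho : V →+ ℤ
  rho_simple (i : Fin n) : rho (simple i) = len i
  /-- the labels of the positive roots -/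
  pos : Finset X
  /-- the positive root with a given label -/
  vec : X → V
  injOn : Set.InjOn vec pos
  rho_pos : ∀ x ∈ pos, 0 < rho (vec x)
  simple_mem (i : Fin n) : ∃ x ∈ pos, vec x = simple i
  reflect_mem : ∀ x ∈ pos, ∀ i, vec x ≠ simple i →
    ∃ y ∈ pos, vec y = vec x - coroot i (vec x) • simple i
  exists_pos : ∀ x ∈ pos, (∃ i, vec x = simple i) ∨ ∃ i, 0 < coroot i (vec x)
  /-- the label of the highest root -/
  high : X
  high_mem : high ∈ pos
  rho_le : ∀ x ∈ pos, rho (vec x) ≤ rho (vec high)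
  /-- the pairing with the highest root -/
  theta : V →+ ℤ
  theta_simple (i : Fin n) : theta (simple i) = coroot i (vec high) * len i

open RatFunc in
/-- The factor `1 - (k / N)² z`. -/
noncomputable def quadFactor {K : Type*} [Field K] (N k : ℤ) : RatFunc K :=
  1 - C (((k : K) / N) ^ 2) * X

namespace RootModel

open RootPairing RootPairing.Base

variable {ι K M N : Type*} [Fintype ι] [Field K] [CharZero K] [AddCommGroup M] [Module K M]
  [AddCommGroup N] [Module K N] {P : RootPairing ι K M N}
  [P.IsCrystallographic] [P.IsReduced] (b : P.Base)
  {n : ℕ} {C : Matrix (Fin n) (Fin n) ℤ} {V X : Type*} [AddCommGroup V] (m : RootModel C V X)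
  (e : b.support ≃ Fin n)

/-- The map from the root lattice to a model. -/
noncomputable def latticeMap : P.rootSpan ℤ →ₗ[ℤ] V :=
  b.toWeightBasisInt.constr ℤ fun i ↦ m.simple (e i)

/-- The image of a root in the model. -/
noncomputable def toVec (i : ι) : V := m.latticeMap b e (P.rootSpanMem ℤ i)

omit [Fintype ι] [P.IsCrystallographic] [P.IsReduced] in
lemma latticeMap_basis (i : b.support) :
    m.latticeMap b e (b.toWeightBasisInt i) = m.simple (e i) := by
  rw [latticeMap, Module.Basis.constr_basis]

omit [Fintype ι] [P.IsCrystallographic] [P.IsReduced] in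
lemma toVec_simple (i : b.support) : m.toVec b e i = m.simple (e i) := by
  have : b.toWeightBasisInt i = P.rootSpanMem ℤ i := Subtype.ext (by simp)
  rw [toVec, ← this, latticeMap_basis]

omit [Fintype ι] [P.IsCrystallographic] [P.IsReduced] in
-- Both sides are additive on the root lattice, of which the simple roots are a basis. Coroots, `ρ`
-- and `θ` are all carried to the model in this way.
lemma apply_root (F : M →ₗ[K] K) (g : V →+ ℤ) (c : K)
    (h : ∀ j : b.support, F (P.root j) = c * g (m.simple (e j))) (i : ι) :
    F (P.root i) = c * g (m.toVec b e i) := by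
  have key : (F.restrictScalars ℤ).comp (P.rootSpan ℤ).subtype =
      (LinearMap.toSpanSingleton ℤ K c).comp (g.toIntLinearMap.comp (m.latticeMap b e)) := by
    refine b.toWeightBasisInt.ext fun j ↦ ?_
    simp [h, mul_comm c, latticeMap_basis]
  simpa [toVec, mul_comm c] using LinearMap.congr_fun key (P.rootSpanMem ℤ i)

omit [Fintype ι] [P.IsCrystallographic] [P.IsReduced] in
lemma toVec_add_zsmul {i j k : ι} {z : ℤ} (h : P.root k = P.root i + z • P.root j) :
    m.toVec b e k = m.toVec b e i + z • m.toVec b e j := by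
  simp only [toVec, ← map_zsmul, ← map_add]
  congr 1
  exact Subtype.ext h

omit [P.IsReduced] in
lemma rho_toVec_pos {i : ι} (hi : b.IsPos i) : 0 < m.rho (m.toVec b e i) := by
  refine hi.induction_on_add (p := fun i ↦ 0 < m.rho (m.toVec b e i)) (fun j hj ↦ ?_)
    (fun i j k hk hi hj ↦ ?_)
  · rw [m.toVec_simple b e ⟨j, hj⟩, m.rho_simple]
    exact m.len_pos _
  · rw [← one_zsmul (P.root j)] at hk
    rw [m.toVec_add_zsmul b e hk, m.toVec_simple b e ⟨j, hj⟩, one_zsmul, map_add, m.rho_simple]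
    have := m.len_pos (e ⟨j, hj⟩)
    lia

section

variable (he : ∀ i j, b.cartanMatrix i j = C (e i) (e j))

include he

omit [Fintype ι] [P.IsReduced] in
lemma coroot_toVec (i : ι) (j : b.support) :
    m.coroot (e j) (m.toVec b e i) = P.pairingIn ℤ i j := by
  have := m.apply_root b e (P.coroot' j) (m.coroot (e j)) 1 (fun k ↦ by
    rw [m.coroot_simple, ← he, one_mul, P.root_coroot'_eq_pairing]
    exact (b.algebraMap_cartanMatrixIn_apply ℤ k j).symm) i
  rw [P.root_coroot'_eq_pairing, ← P.algebraMap_pairingIn ℤ, one_mul] at this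
  rw [eq_intCast (algebraMap ℤ K)] at this
  exact_mod_cast this.symm

omit [Fintype ι] [P.IsReduced] in
lemma toVec_reflectionPerm (i : ι) (j : b.support) :
    m.toVec b e (P.reflectionPerm j i) =
      m.toVec b e i - m.coroot (e j) (m.toVec b e i) • m.simple (e j) := by
  rw [m.coroot_toVec b e he, ← m.toVec_simple b e j, sub_eq_add_neg, ← neg_smul]
  apply m.toVec_add_zsmul
  rw [root_reflectionPerm, neg_smul, P.reflection_apply_root' ℤ, sub_eq_add_neg]

omit [Fintype ι] [P.IsReduced] in
lemma toVec_injective [Finite ι] [P.IsRootSystem] : Function.Injective (m.toVec b e) := by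
  intro i j hij
  apply b.injective_pairingIn
  ext k
  simp only [← m.coroot_toVec b e he, hij]

/-- Simple reflections generate all roots from the simple ones, and the model together with its
negatives is stable under them. So the image of a root is a model vector up to sign, and positivity
of `rho` fixes the sign. -/
lemma exists_vec_eq {i : ι} (hi : b.IsPos i) : ∃ x ∈ m.pos, m.vec x = m.toVec b e i := by
  have key : (∃ x ∈ m.pos, m.vec x = m.toVec b e i) ∨
      (∃ x ∈ m.pos, m.vec x = -m.toVec b e i) := by
    refine hi.induction_on_reflect (p := fun i ↦ (∃ x ∈ m.pos, m.vec x = m.toVec b e i) ∨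
      (∃ x ∈ m.pos, m.vec x = -m.toVec b e i)) (fun j hj ↦ ?_) (fun i j hi hj ↦ ?_)
    · rw [m.toVec_simple b e ⟨j, hj⟩]
      exact Or.inl (m.simple_mem _)
    · have hr := m.toVec_reflectionPerm b e he i ⟨j, hj⟩
      simp only at hr
      rw [hr]
      set k := e ⟨j, hj⟩
      have hc : m.coroot k (m.simple k) = 2 := by
        rw [m.coroot_simple, ← he, b.cartanMatrix_apply_same]
      obtain ⟨x, hx, hxi⟩ | ⟨x, hx, hxi⟩ := hi
      · rw [← hxi]
        by_cases h : m.vec x = m.simple k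
        · refine Or.inr ⟨x, hx, ?_⟩
          rw [h, hc]; module
        · exact Or.inl (m.reflect_mem x hx k h)
      · rw [← neg_eq_iff_eq_neg] at hxi
        rw [← hxi]
        by_cases h : m.vec x = m.simple k
        · refine Or.inl ⟨x, hx, ?_⟩
          rw [h, map_neg, hc]; module
        · obtain ⟨y, hy, hyx⟩ := m.reflect_mem x hx k h
          refine Or.inr ⟨y, hy, ?_⟩
          rw [hyx, map_neg]; module
  refine key.resolve_right ?_
  rintro ⟨x, hx, hxi⟩
  have h1 := m.rho_pos x hx
  have h2 := m.rho_toVec_pos b e hi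
  rw [hxi, map_neg] at h1
  lia

/-- Descent on `rho`: a non-simple vector is positive on some simple coroot, so reflecting there
lowers `rho` within the model. The root found for the lower vector is then reflected back. -/
lemma exists_toVec_eq {x : X} (hx : x ∈ m.pos) : ∃ i, b.IsPos i ∧ m.toVec b e i = m.vec x := by
  generalize hr : (m.rho (m.vec x)).toNat = r
  induction r using Nat.strongRecOn generalizing x with
  | ind r ih =>
    by_cases hs : ∃ k, m.vec x = m.simple k
    · obtain ⟨k, hk⟩ := hs
      obtain ⟨j, rfl⟩ := e.surjective k
      exact ⟨j, b.isPos_of_mem_support j.2, by rw [hk, m.toVec_simple]⟩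
    · obtain ⟨k, hk⟩ := (m.exists_pos x hx).resolve_left hs
      obtain ⟨y, hy, hyx⟩ := m.reflect_mem x hx k (fun h ↦ hs ⟨k, h⟩)
      obtain ⟨j, rfl⟩ := e.surjective k
      have hlt : (m.rho (m.vec y)).toNat < r := by
        have h1 : m.rho (m.vec y) =
            m.rho (m.vec x) - m.coroot (e j) (m.vec x) * m.len (e j) := by
          rw [hyx, map_sub, map_zsmul, m.rho_simple, smul_eq_mul]
        have h2 := m.rho_pos y hy
        have h3 := mul_pos hk (m.len_pos (e j))
        lia
      obtain ⟨i, hi, hiy⟩ := ih _ hlt hy rfl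
      have hc : m.coroot (e j) (m.simple (e j)) = 2 := by
        rw [m.coroot_simple, ← he, b.cartanMatrix_apply_same]
      -- If the lower vector were the simple root itself, the original would pair to `-2` with its
      -- coroot instead of positively.
      have hij : i ≠ j := by
        rintro rfl
        have h4 := congr_arg (m.coroot (e j)) hyx
        rw [← hiy, m.toVec_simple, map_sub, map_zsmul, hc, smul_eq_mul] at h4
        lia
      refine ⟨P.reflectionPerm j i, hi.reflectionPerm j.2 hij, ?_⟩
      rw [m.toVec_reflectionPerm b e he, hiy, hyx, map_sub, map_zsmul, hc]
      simp only [smul_eq_mul]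
      module

/-- Let `k` be the root that maps to the top of the model. `rho` at `θ` does not exceed its value at
`k`, yet `θ - k` is a nonnegative sum of simple roots, on which `rho` is positive unless the sum is
zero. -/
lemma toVec_highest [P.IsRootSystem] {θ : ι} (hθ : b.IsHighestRoot θ) :
    m.toVec b e θ = m.vec m.high := by
  obtain ⟨k, hk, hkx⟩ := m.exists_toVec_eq b e he m.high_mem
  have hle : m.rho (m.toVec b e θ) ≤ m.rho (m.toVec b e k) := by
    rw [hkx]
    rcases IsPos.or_neg b θ with h | h
    · obtain ⟨x, hx, hxi⟩ := m.exists_vec_eq b e he h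
      rw [← hxi]
      exact m.rho_le x hx
    · have h1 := m.rho_toVec_pos b e h
      have h2 : m.toVec b e (P.reflectionPerm θ θ) = -m.toVec b e θ := by
        have := m.toVec_add_zsmul b e (i := θ) (j := θ) (k := P.reflectionPerm θ θ) (z := -2)
          (by rw [root_reflectionPerm, reflection_apply_self]; module)
        rw [this]; module
      have h3 := m.rho_pos _ m.high_mem
      change 0 < m.rho (m.toVec b e (P.reflectionPerm θ θ)) at h1
      rw [h2, map_neg] at h1
      lia
  -- The extension of `rho` to the whole space, needed because `θ - k` is a vector of `M` and not a
  -- root.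
  let F : M →ₗ[K] K := b.toWeightBasis.constr K fun j ↦ (m.len (e j) : K)
  have hF (j : b.support) : F (P.root j) = m.len (e j) := by
    rw [← b.toWeightBasis_apply, Module.Basis.constr_basis]
  have hF' (i : ι) : F (P.root i) = m.rho (m.toVec b e i) := by
    simpa using m.apply_root b e F m.rho 1 (fun j ↦ by rw [hF, m.rho_simple, one_mul]) i
  have key (x : M) (hx : x ∈ AddSubmonoid.closure (P.root '' b.support)) :
      ∃ z : ℤ, 0 ≤ z ∧ F x = z ∧ (z = 0 → x = 0) := by
    induction hx using AddSubmonoid.closure_induction with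
    | mem x hx =>
      obtain ⟨j, hj, rfl⟩ := hx
      have := m.len_pos (e ⟨j, hj⟩)
      exact ⟨m.len (e ⟨j, hj⟩), this.le, hF ⟨j, hj⟩, fun h ↦ by lia⟩
    | zero => exact ⟨0, by simp⟩
    | add x y _ _ hx hy =>
      obtain ⟨z, hz, hxz, h0⟩ := hx
      obtain ⟨w, hw, hyw, h0'⟩ := hy
      refine ⟨z + w, by lia, by simp [hxz, hyw], fun h ↦ ?_⟩
      rw [h0 (by lia), h0' (by lia), add_zero]
  obtain ⟨z, hz, hxz, h0⟩ := key _ (hθ k)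
  rw [map_sub, hF', hF'] at hxz
  have hz' : m.rho (m.toVec b e θ) - m.rho (m.toVec b e k) = z := by exact_mod_cast hxz
  have := h0 (by lia)
  rw [sub_eq_zero, P.root.apply_eq_iff_eq] at this
  rw [this, hkx]

end

end RootModel

/-- Apply the reflection `s` in the root `α` to both arguments: `(x, α) = (s x, s α) = -(x - ⟨x,
α^∨⟩ α, α)`. -/
lemma RootPairing.InvariantForm.two_mul_apply_root {ι K M N : Type*} [CommRing K] [AddCommGroup M]
    [Module K M] [AddCommGroup N] [Module K N] {P : RootPairing ι K M N} (B : P.InvariantForm)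
    (x : M) (j : ι) :
    2 * B.form x (P.root j) = P.coroot' j x * B.form (P.root j) (P.root j) := by
  have h := B.apply_reflection_reflection j x (P.root j)
  rw [RootPairing.reflection_apply_self, RootPairing.reflection_apply] at h
  simp only [map_sub, map_smul, map_neg, LinearMap.sub_apply, LinearMap.smul_apply,
    smul_eq_mul] at h
  linear_combination -h

namespace RootModel

/-- The product over the positive roots in a model that computes `F^B(θ, z)`. -/
noncomputable def product (K : Type*) [Field K] {n : ℕ} {C : Matrix (Fin n) (Fin n) ℤ}
    {V X : Type*} [AddCommGroup V] (m : RootModel C V X) (D : ℤ) : RatFunc K := ∏ x ∈ m.pos,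
  quadFactor D (m.rho (m.vec x) + m.theta (m.vec x)) / quadFactor D (m.rho (m.vec x))

open RootPairing RootPairing.Base

variable {ι K M N : Type*} [Fintype ι] [Field K] [CharZero K] [AddCommGroup M] [Module K M]
  [AddCommGroup N] [Module K N] {P : RootPairing ι K M N} [P.IsRootSystem]
  [P.IsCrystallographic] [P.IsReduced] [P.IsIrreducible] (b : P.Base) (B : P.InvariantForm)
  {n : ℕ} {C : Matrix (Fin n) (Fin n) ℤ} {V X : Type*} [AddCommGroup V] (m : RootModel C V X)
  (e : b.support ≃ Fin n) (he : ∀ i j, b.cartanMatrix i j = C (e i) (e j))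

include he

omit [P.IsRootSystem] in
-- The ratio of `(αⱼ, αⱼ)` to `len` is unchanged along an edge, because the same Cartan entries
-- symmetrise both; connectedness makes it constant, and `κ` is half of it.
lemma exists_form_eq :
    ∃ κ : K, ∀ (j : b.support) (x : M), B.form x (P.root j) = P.coroot' j x * κ * m.len (e j) := by
  suffices h : ∃ κ : K, ∀ j : b.support, B.form (P.root j) (P.root j) = 2 * κ * m.len (e j) by
    obtain ⟨κ, h⟩ := h
    refine ⟨κ, fun j x ↦ ?_⟩
    have := B.two_mul_apply_root x j
    rw [h] at this
    linear_combination (1 / 2 : K) * this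
  cases isEmpty_or_nonempty b.support with
  | inl h => exact ⟨0, fun j ↦ isEmptyElim j⟩
  | inr h =>
    obtain ⟨i₀⟩ := h
    have hl (j : b.support) : (m.len (e j) : K) ≠ 0 := by
      exact_mod_cast (m.len_pos (e j)).ne'
    have key (j : b.support) : B.form (P.root i₀) (P.root i₀) * m.len (e j) =
        B.form (P.root j) (P.root j) * m.len (e i₀) := by
      refine b.induction_on_cartanMatrix
        (p := fun j ↦ B.form (P.root i₀) (P.root i₀) * m.len (e j) =
        B.form (P.root j) (P.root j) * m.len (e i₀)) (i := i₀) rfl fun i j hi hij ↦ ?_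
      have h1 := B.pairing_mul_eq_pairing_mul_swap (i : ι) j
      have h2 : (b.cartanMatrix i j : K) * m.len (e j) = b.cartanMatrix j i * m.len (e i) := by
        rw [he, he]
        exact_mod_cast m.len_symm _ _
      have h3 (k l : b.support) : (b.cartanMatrix k l : K) = P.pairing k l :=
        b.algebraMap_cartanMatrixIn_apply ℤ k l
      have h4 : (b.cartanMatrix j i : K) ≠ 0 := by exact_mod_cast hij
      have h5 : (b.cartanMatrix i j : K) ≠ 0 := by
        intro h
        rw [h, zero_mul] at h2
        exact mul_ne_zero h4 (hl i) h2.symm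
      rw [← h3, ← h3] at h1
      refine mul_left_cancel₀ (mul_ne_zero h5 (hl i)) ?_
      linear_combination (b.cartanMatrix i j : K) * m.len (e j) * hi +
        B.form (P.root i) (P.root i) * m.len (e i₀) * h2 + m.len (e i) * m.len (e i₀) * h1
    refine ⟨B.form (P.root i₀) (P.root i₀) / (2 * m.len (e i₀)), fun j ↦ ?_⟩
    have := hl i₀
    field_simp
    linear_combination -key j

/-- The pairings with `ρ` and `θ` are `κ` times the integers of the model. Comparing `(θ, θ) = 2`
with the model's value `2 D` gives `κ = 1 / D`, and the positive roots correspond bijectively to the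
labels. -/
theorem casimirProduct_eq {θ : ι} (hθ : b.IsHighestRoot θ)
    (hB : B.form (P.root θ) (P.root θ) = 2) {D : ℤ} (hD : m.theta (m.vec m.high) = 2 * D) :
    b.casimirProduct B (P.root θ) = m.product K D := by
  obtain ⟨κ, hκ⟩ := m.exists_form_eq b B e he
  have hρ (i : ι) : B.form b.weylVector (P.root i) = κ * m.rho (m.toVec b e i) :=
    m.apply_root b e (B.form b.weylVector) m.rho κ (fun j ↦ by
      rw [hκ, coroot'_weylVector b j.2, m.rho_simple, one_mul]) i
  have hτ (i : ι) : B.form (P.root θ) (P.root i) = κ * m.theta (m.toVec b e i) :=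
    m.apply_root b e (B.form (P.root θ)) m.theta κ (fun j ↦ by
      rw [hκ, m.theta_simple, ← m.toVec_highest b e he hθ, m.coroot_toVec b e he,
        P.root_coroot'_eq_pairing, ← P.algebraMap_pairingIn ℤ]
      simp
      ring) i
  have hκD : κ * D = 1 := by
    have := hτ θ
    rw [hB, m.toVec_highest b e he hθ, hD] at this
    push_cast at this
    linear_combination (-1 / 2 : K) * this
  have hD0 : (D : K) ≠ 0 := right_ne_zero_of_mul_eq_one hκD
  have hκ' : κ = 1 / D := by field_simp; exact hκD
  rw [casimirProduct, product]
  have hx (i : ι) (hi : b.IsPos i) := m.exists_vec_eq b e he hi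
  have : Nonempty X := ⟨m.high⟩
  choose! f hf hfv using hx
  refine Finset.prod_bij (fun i _ ↦ f i) (fun i hi ↦ hf i (by simpa using hi)) ?_ ?_ ?_
  · intro i hi j hj hij
    apply m.toVec_injective b e he
    rw [← hfv i (by simpa using hi), ← hfv j (by simpa using hj), hij]
  · intro x hx
    obtain ⟨i, hi, hix⟩ := m.exists_toVec_eq b e he hx
    exact ⟨i, by simpa using hi, m.injOn (hf i hi) hx (by rw [hfv i hi, hix])⟩
  · intro i hi
    have hi' : b.IsPos i := by simpa using hi
    rw [hfv i hi', map_add, LinearMap.add_apply, hρ, hτ, hκ', quadFactor, quadFactor]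
    push_cast
    ring_nf

end RootModel

/-! ### Quadratic factors in `z` -/

namespace quadFactor

variable {K : Type*} [Field K]

open RatFunc

/-- The constant term is 1. -/
lemma ne_zero (N k : ℤ) : (quadFactor N k : RatFunc K) ≠ 0 := by
  intro h
  have h1 : (algebraMap (Polynomial K) (RatFunc K))
      (1 - Polynomial.C (((k : K) / N) ^ 2) * Polynomial.X) = 0 := by
    simpa [quadFactor] using h
  rw [map_eq_zero_iff _ (RatFunc.algebraMap_injective K)] at h1
  simpa using congr_arg (Polynomial.eval 0) h1

/-- The hypotheses compare squares because the signs of `x` and `2t - x` are immaterial; the common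
factor 4 cancels. -/
lemma vogelFactor_eq [CharZero K] {N : ℤ} {a c : ℤ} {t x : K}
    (ha : (2 * t - x) ^ 2 = (2 * (a / N)) ^ 2) (hc : x ^ 2 = (2 * (c / N)) ^ 2) :
    vogelFactor t x = quadFactor N a / quadFactor N c := by
  have h4 (k : K) : (4 - RatFunc.C ((2 * k) ^ 2) * RatFunc.X : RatFunc K) =
      4 * (1 - RatFunc.C (k ^ 2) * RatFunc.X) := by
    simp only [mul_pow, map_mul, map_pow, map_ofNat]
    ring
  have h0 : (4 : RatFunc K) ≠ 0 := by
    have := (map_ne_zero (RatFunc.C : K →+* RatFunc K)).mpr (by norm_num : (4 : K) ≠ 0)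
    rwa [map_ofNat] at this
  rw [vogelFactor, ha, hc, h4, h4, mul_div_mul_left _ _ h0, quadFactor, quadFactor]

end quadFactor

/-! ### Exceptional types, with positive roots encoded by decimal digits -/

namespace RootModel

/-- The linear form on `ℤⁿ` with given coefficients. -/
def linearForm {n : ℕ} (c : Fin n → ℤ) : (Fin n → ℤ) →+ ℤ :=
  AddMonoidHom.mk' (fun v ↦ ∑ i, v i * c i) fun v w ↦ by
    simp [add_mul, Finset.sum_add_distrib]

lemma linearForm_single {n : ℕ} (c : Fin n → ℤ) (i : Fin n) :
    linearForm c (Pi.single i 1) = c i := by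
  simp [linearForm, Pi.single_apply]

/-- The vector whose coordinates are the first `n` decimal digits of a number. -/
def digits (n c : ℕ) : Fin n → ℤ := fun i ↦ (c / 10 ^ (i : ℕ) % 10 : ℕ)

/-- The number with given decimal digits. -/
def ofDigits {n : ℕ} (v : Fin n → ℤ) : ℕ := ∑ i, (v i).toNat * 10 ^ (i : ℕ)

/-- Whether a vector is the vector of digits of a number in a list. -/
def memDigits {n : ℕ} (L : List ℕ) (v : Fin n → ℤ) : Bool :=
  -- The second test rejects vectors with a coordinate outside `0, …, 9`, whose code could coincide
  -- with that of another vector.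
  L.elem (ofDigits v) && decide (digits n (ofDigits v) = v)

lemma exists_of_memDigits {n : ℕ} {L : List ℕ} {v : Fin n → ℤ} (h : memDigits L v = true) :
    ∃ c ∈ L.toFinset, digits n c = v := by
  simp only [memDigits, Bool.and_eq_true, decide_eq_true_eq, List.elem_eq_mem] at h
  exact ⟨_, by simpa using h.1, h.2⟩

/-- Whether the numbers in a list are the coordinates, with respect to the simple roots, of the
positive roots of a root system with Cartan matrix `C`, the highest root being `h`. -/
def isCodes {n : ℕ} (C : Matrix (Fin n) (Fin n) ℤ) (len : Fin n → ℤ) (L : List ℕ) (h : ℕ) : Bool :=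
  decide (∀ i, 0 < len i) && decide (∀ i j, C i j * len j = C j i * len i) &&
  decide (∀ c ∈ L, ofDigits (digits n c) = c) &&
  decide (∀ c ∈ L, 0 < linearForm len (digits n c)) &&
  decide (∀ i : Fin n, memDigits L (Pi.single i 1) = true) &&
  decide (∀ c ∈ L, ∀ i, c = ofDigits (Pi.single i 1 : Fin n → ℤ) ∨ memDigits L (digits n c -
    linearForm (fun j ↦ C j i) (digits n c) • (Pi.single i 1 : Fin n → ℤ)) = true) &&
  decide (∀ c ∈ L, (∃ i, digits n c = Pi.single i 1) ∨
    ∃ i, 0 < linearForm (fun j ↦ C j i) (digits n c)) &&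
  L.elem h && decide (∀ c ∈ L, linearForm len (digits n c) ≤ linearForm len (digits n h))

/-- The model of a root system given by the coordinates of the positive roots. -/
def ofCodes {n : ℕ} (C : Matrix (Fin n) (Fin n) ℤ) (len : Fin n → ℤ) (L : List ℕ) (h : ℕ)
    (hL : isCodes C len L h = true) : RootModel C (Fin n → ℤ) ℕ := by
  simp only [isCodes, Bool.and_eq_true, decide_eq_true_eq, List.elem_eq_mem] at hL
  exact
  { simple := fun i ↦ Pi.single i 1
    coroot := fun i ↦ linearForm fun j ↦ C j i
    coroot_simple := fun i j ↦ linearForm_single _ _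
    len := len
    len_pos := hL.1.1.1.1.1.1.1.1
    len_symm := hL.1.1.1.1.1.1.1.2
    rho := linearForm len
    rho_simple := linearForm_single len
    pos := L.toFinset
    vec := digits n
    injOn := fun c hc d hd hcd ↦ by
      have := hL.1.1.1.1.1.1.2
      rw [← this c (by simpa using hc), ← this d (by simpa using hd), hcd]
    rho_pos := fun c hc ↦ hL.1.1.1.1.1.2 c (by simpa using hc)
    simple_mem := fun i ↦ exists_of_memDigits (hL.1.1.1.1.2 i)
    reflect_mem := fun c hc i hi ↦ by
      obtain hci | hci := hL.1.1.1.2 c (by simpa using hc) i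
      · obtain ⟨-, h2⟩ : _ ∧ _ := by
          simpa only [memDigits, Bool.and_eq_true, decide_eq_true_eq] using hL.1.1.1.1.2 i
        exact (hi (by rw [hci, h2])).elim
      · exact exists_of_memDigits hci
    exists_pos := fun c hc ↦ hL.1.1.2 c (by simpa using hc)
    high := h
    high_mem := by simpa using hL.1.2
    rho_le := fun c hc ↦ hL.2 c (by simpa using hc)
    theta := linearForm fun i ↦ linearForm (fun j ↦ C j i) (digits n h) * len i
    theta_simple := linearForm_single _ }

/-- The list of positive roots of the root system of type `E₈`. -/
def codesE₈ : List ℕ :=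
  [1, 10, 100, 101, 1000, 1010, 1100, 1101, 1110, 1111, 10000, 11000, 11010, 11100, 11101, 11110,
   11111, 12110, 12111, 12211, 100000, 110000, 111000, 111010, 111100, 111101, 111110, 111111,
   112110, 112111, 112211, 122110, 122111, 122211, 123211, 123221, 1000000, 1100000, 1110000,
   1111000, 1111010, 1111100, 1111101, 1111110, 1111111, 1112110, 1112111, 1112211, 1122110,
   1122111, 1122211, 1123211, 1123221, 1222110, 1222111, 1222211, 1223211, 1223221, 1233211,
   1233221, 1234221, 1234321, 1234322, 10000000, 11000000, 11100000, 11110000, 11111000, 11111010,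
   11111100, 11111101, 11111110, 11111111, 11112110, 11112111, 11112211, 11122110, 11122111,
   11122211, 11123211, 11123221, 11222110, 11222111, 11222211, 11223211, 11223221, 11233211,
   11233221, 11234221, 11234321, 11234322, 12222110, 12222111, 12222211, 12223211, 12223221,
   12233211, 12233221, 12234221, 12234321, 12234322, 12333211, 12333221, 12334221, 12334321,
   12334322, 12344221, 12344321, 12344322, 12345321, 12345322, 12345331, 12345332, 12345422,
   12345432, 12346432, 12356432, 12456432, 13456432, 23456432]

/-- The list of positive roots of the root system of type `F₄`. -/
def codesF₄ : List ℕ :=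
  [1, 10, 11, 100, 110, 111, 210, 211, 221, 1000, 1100, 1110, 1111, 1210, 1211, 1221, 1321, 2210,
   2211, 2221, 2321, 2421, 2431, 2432]

/-- The list of positive roots of the root system of type `G₂`. -/
def codesG₂ : List ℕ :=
  [1, 10, 11, 21, 31, 32]

/-- A model of the root system of type `E₈`. -/
def modelE₈ : RootModel CartanMatrix.E₈ (Fin 8 → ℤ) ℕ :=
  ofCodes _ 1 codesE₈ 23456432 (by decide +kernel)

/-- A model of the root system of type `E₇`. -/
def modelE₇ : RootModel CartanMatrix.E₇ (Fin 7 → ℤ) ℕ :=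
  -- The list for E₈ is increasing and the last simple root has the leading digit, so the roots of
  -- E₇ are the 63 codes below `10 ^ 7`; likewise E₆ has the 36 codes below `10 ^ 6`.
  ofCodes _ 1 (codesE₈.take 63) 1234322 (by decide +kernel)

/-- A model of the root system of type `E₆`. -/
def modelE₆ : RootModel CartanMatrix.E₆ (Fin 6 → ℤ) ℕ :=
  ofCodes _ 1 (codesE₈.take 36) 123221 (by decide +kernel)

/-- A model of the root system of type `F₄`. -/
def modelF₄ : RootModel CartanMatrix.F₄ (Fin 4 → ℤ) ℕ :=
  ofCodes _ ![2, 2, 1, 1] codesF₄ 2432 (by decide +kernel)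

/-- A model of the root system of type `G₂`. -/
def modelG₂ : RootModel CartanMatrix.G₂ (Fin 2 → ℤ) ℕ :=
  ofCodes _ ![3, 1] codesG₂ 32 (by decide +kernel)

end RootModel

/-- Cancelling equal factors is a statement about multisets, which turns the exceptional cases into
a decidable permutation of lists of integers. -/
lemma Finset.prod_div_eq_of_isPerm {X F : Type*} [DecidableEq X] [Field F] {f : ℤ → F}
    (hf : ∀ k, f k ≠ 0) {L : List X} (hL : L.Nodup) {p q : X → ℤ} {a c : List ℤ}
    (h : (L.map p ++ c).isPerm (L.map q ++ a) = true) :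
    ∏ x ∈ L.toFinset, f (p x) / f (q x) = (a.map f).prod / (c.map f).prod := by
  have h1 := ((List.isPerm_iff.mp h).map f).prod_eq
  simp only [List.map_append, List.prod_append, List.map_map] at h1
  have h0 (l : List ℤ) : (l.map f).prod ≠ 0 := by
    simp [List.prod_eq_zero_iff, hf]
  have h2 := h0 (L.map q)
  rw [List.map_map] at h2
  rw [Finset.prod_div_distrib, List.prod_toFinset _ hL, List.prod_toFinset _ hL]
  change (L.map (f ∘ p)).prod / (L.map (f ∘ q)).prod = _
  rw [div_eq_div_iff h2 (h0 c)]
  exact h1.trans (mul_comm _ _)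

namespace RootModel

variable {K : Type*} [Field K]

/-- The surviving integers are `N |2t - x| / 2` above and `N |x| / 2` below, for `x = α, β, γ`; here
`N = 1` and `t = 30`. The other exceptional types follow the same rule, with `N = 2` for F₄ and `N =
3` for G₂. -/
lemma product_modelE₈ : modelE₈.product K 1 =
    (([31, 24, 20] : List ℤ).map (quadFactor 1)).prod /
      (([1, 6, 10] : List ℤ).map (quadFactor 1)).prod :=
  Finset.prod_div_eq_of_isPerm (quadFactor.ne_zero 1) (by decide +kernel : codesE₈.Nodup)
    (p := fun x ↦ modelE₈.rho (modelE₈.vec x) + modelE₈.theta (modelE₈.vec x))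
    (q := fun x ↦ modelE₈.rho (modelE₈.vec x)) (by decide +kernel)

lemma product_modelE₇ : modelE₇.product K 1 =
    (([19, 14, 12] : List ℤ).map (quadFactor 1)).prod /
      (([1, 4, 6] : List ℤ).map (quadFactor 1)).prod :=
  Finset.prod_div_eq_of_isPerm (quadFactor.ne_zero 1)
    (by decide +kernel : (codesE₈.take 63).Nodup)
    (p := fun x ↦ modelE₇.rho (modelE₇.vec x) + modelE₇.theta (modelE₇.vec x))
    (q := fun x ↦ modelE₇.rho (modelE₇.vec x)) (by decide +kernel)

lemma product_modelE₆ : modelE₆.product K 1 =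
    (([13, 9, 8] : List ℤ).map (quadFactor 1)).prod /
      (([1, 3, 4] : List ℤ).map (quadFactor 1)).prod :=
  Finset.prod_div_eq_of_isPerm (quadFactor.ne_zero 1)
    (by decide +kernel : (codesE₈.take 36).Nodup)
    (p := fun x ↦ modelE₆.rho (modelE₆.vec x) + modelE₆.theta (modelE₆.vec x))
    (q := fun x ↦ modelE₆.rho (modelE₆.vec x)) (by decide +kernel)

lemma product_modelF₄ : modelF₄.product K 2 =
    (([20, 13, 12] : List ℤ).map (quadFactor 2)).prod /
      (([2, 5, 6] : List ℤ).map (quadFactor 2)).prod :=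
  Finset.prod_div_eq_of_isPerm (quadFactor.ne_zero 2) (by decide +kernel : codesF₄.Nodup)
    (p := fun x ↦ modelF₄.rho (modelF₄.vec x) + modelF₄.theta (modelF₄.vec x))
    (q := fun x ↦ modelF₄.rho (modelF₄.vec x)) (by decide +kernel)

lemma product_modelG₂ : modelG₂.product K 3 =
    (([15, 7, 8] : List ℤ).map (quadFactor 3)).prod /
      (([3, 5, 4] : List ℤ).map (quadFactor 3)).prod :=
  Finset.prod_div_eq_of_isPerm (quadFactor.ne_zero 3) (by decide +kernel : codesG₂.Nodup)
    (p := fun x ↦ modelG₂.rho (modelG₂.vec x) + modelG₂.theta (modelG₂.vec x))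
    (q := fun x ↦ modelG₂.rho (modelG₂.vec x)) (by decide +kernel)

lemma theta_high_modelE₈ : modelE₈.theta (modelE₈.vec modelE₈.high) = 2 * 1 := by decide +kernel

lemma theta_high_modelE₇ : modelE₇.theta (modelE₇.vec modelE₇.high) = 2 * 1 := by decide +kernel

lemma theta_high_modelE₆ : modelE₆.theta (modelE₆.vec modelE₆.high) = 2 * 1 := by decide +kernel

lemma theta_high_modelF₄ : modelF₄.theta (modelF₄.vec modelF₄.high) = 2 * 2 := by decide +kernel

lemma theta_high_modelG₂ : modelG₂.theta (modelG₂.vec modelG₂.high) = 2 * 3 := by decide +kernel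

end RootModel

/-! ### Classical types, with positive roots written as `eᵢ + s eⱼ` -/

/-- The vector `eᵢ + s eⱼ` attached to a triple `(i, j, s)`. -/
noncomputable def signVec (x : ℕ × ℕ × ℤ) : ℕ →₀ ℤ :=
  Finsupp.single x.1 1 + Finsupp.single x.2.1 x.2.2

/-- The triples `(i, j, s)` with `i < j < n` and `s ∈ S`, or with `i = j < n` and `s ∈ U`. -/
def signTriples (n : ℕ) (S U : Finset ℤ) : Finset (ℕ × ℕ × ℤ) :=
  {x ∈ Finset.range n ×ˢ Finset.range n ×ˢ S | x.1 < x.2.1} ∪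
    (Finset.range n ×ˢ U).image fun x ↦ (x.1, x.1, x.2)

section signTriples

variable {n : ℕ} {S U : Finset ℤ}

lemma mem_signTriples {i j : ℕ} {s : ℤ} :
    (i, j, s) ∈ signTriples n S U ↔ (i < j ∧ j < n ∧ s ∈ S) ∨ (i = j ∧ j < n ∧ s ∈ U) := by
  simp only [signTriples, Finset.mem_union, Finset.mem_filter, Finset.mem_product,
    Finset.mem_range, Finset.mem_image, Prod.mk.injEq, Prod.exists]
  refine or_congr (by grind) ⟨?_, ?_⟩
  · rintro ⟨a, c, h, rfl, rfl, rfl⟩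
    exact ⟨rfl, h⟩
  · rintro ⟨rfl, h⟩
    exact ⟨i, s, h, rfl, rfl, rfl⟩

lemma prod_signTriples {F : Type*} [CommMonoid F] (f : ℕ × ℕ × ℤ → F) :
    ∏ x ∈ signTriples n S U, f x =
      (∏ i ∈ Finset.range n, ∏ j ∈ Finset.range n, if i < j then ∏ s ∈ S, f (i, j, s) else 1) *
        ∏ i ∈ Finset.range n, ∏ s ∈ U, f (i, i, s) := by
  rw [signTriples, Finset.prod_union, Finset.prod_filter, Finset.prod_product, Finset.prod_image,
    Finset.prod_product]
  · congr 1
    refine Finset.prod_congr rfl fun i _ ↦ ?_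
    rw [Finset.prod_product]
    refine Finset.prod_congr rfl fun j _ ↦ ?_
    split_ifs <;> simp_all
  · rintro ⟨i, s⟩ - ⟨j, t⟩ - h
    simp_all
  · rw [Finset.disjoint_left]
    rintro ⟨i, j, s⟩ h h'
    simp only [Finset.mem_filter, Finset.mem_image, Prod.mk.injEq, Prod.exists] at h h'
    grind

lemma signVec_apply (i j : ℕ) (s : ℤ) (k : ℕ) :
    signVec (i, j, s) k = (if i = k then 1 else 0) + if j = k then s else 0 := by
  simp [signVec, Finsupp.single_apply]

/-- The index `i` is the first coordinate at which the vector is nonzero. Subtracting `eᵢ` leaves `s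
eⱼ`, which determines `j` and `s` unless `s = 0`, and that occurs only for `j = i`. -/
lemma injOn_signVec (hS : ∀ s ∈ S, s = 1 ∨ s = -1) (hU : ∀ s ∈ U, 0 ≤ s) :
    Set.InjOn signVec (signTriples n S U) := by
  have aux {i j i' j' : ℕ} {s s' : ℤ} (h : (i, j, s) ∈ signTriples n S U)
      (h' : (i', j', s') ∈ signTriples n S U)
      (hv : signVec (i, j, s) = signVec (i', j', s')) : i' ≤ i := by
    by_contra! hlt
    rw [mem_signTriples] at h h'
    have hle : i' ≤ j' := by grind
    have h1 := DFunLike.congr_fun hv i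
    rw [signVec_apply, signVec_apply, if_pos rfl, if_neg (c := i' = i) (by omega),
      if_neg (c := j' = i) (by omega)] at h1
    split_ifs at h1 with hij
    · have := hU s (by grind)
      omega
    · omega
  rintro ⟨i, j, s⟩ h ⟨i', j', s'⟩ h' hv
  obtain rfl : i = i' := le_antisymm (aux h' h hv.symm) (aux h h' hv)
  have h1 : Finsupp.single j s = Finsupp.single j' s' := by simpa [signVec] using hv
  rw [Finsupp.single_eq_single_iff] at h1
  obtain ⟨rfl, rfl⟩ | ⟨rfl, rfl⟩ := h1
  · rfl
  · have h0 : (0 : ℤ) ∉ S := fun h ↦ by simpa using hS 0 h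
    simp only [Finset.mem_coe, mem_signTriples, h0, and_false, false_or] at h h'
    rw [← h.1, ← h'.1]

/-- A simple reflection that swaps two coordinates. -/
lemma exists_signVec_swap (hS : ∀ s ∈ S, s = 1 ∨ s = -1) {k : ℕ} (hk : k + 1 < n)
    {x : ℕ × ℕ × ℤ} (hx : x ∈ signTriples n S U) (hxk : signVec x ≠ signVec (k, k + 1, -1)) :
    ∃ y ∈ signTriples n S U,
      signVec y = signVec x - (signVec x k - signVec x (k + 1)) • signVec (k, k + 1, -1) := by
  obtain ⟨i, j, s⟩ := x
  rw [mem_signTriples] at hx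
  -- Exchanging the coordinates would break `i < j` only here. As the simple root itself is
  -- excluded, `s = 1` and the vector is fixed.
  by_cases hij : i = k ∧ j = k + 1
  · obtain ⟨rfl, rfl⟩ := hij
    refine ⟨(i, i + 1, s), mem_signTriples.mpr hx, ?_⟩
    obtain rfl : s = 1 := (hS s (by grind)).resolve_right fun h ↦ hxk (by rw [h])
    simp [signVec_apply]
  · refine ⟨(Equiv.swap k (k + 1) i, Equiv.swap k (k + 1) j, s), ?_, ?_⟩
    · rw [mem_signTriples]
      simp only [Equiv.swap_apply_def]
      grind
    · ext l
      simp only [Finsupp.sub_apply, Finsupp.smul_apply, signVec_apply, smul_eq_mul,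
        Equiv.swap_apply_def]
      grind

end signTriples

/-- The linear form taking given values on the standard basis. -/
noncomputable def weightForm (r : ℕ → ℤ) : (ℕ →₀ ℤ) →+ ℤ :=
  (Finsupp.linearCombination ℤ r).toAddMonoidHom

lemma weightForm_signVec (r : ℕ → ℤ) (i j : ℕ) (s : ℤ) :
    weightForm r (signVec (i, j, s)) = r i + s * r j := by
  simp [weightForm, signVec]

namespace RootModel

/-- A model of the root system of type `Aₙ`. -/
noncomputable def modelA (n : ℕ) (hn : 1 ≤ n) :
    RootModel (CartanMatrix.A n) (ℕ →₀ ℤ) (ℕ × ℕ × ℤ) where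
  simple k := signVec (k, k + 1, -1)
  coroot k := Finsupp.applyAddHom (k : ℕ) - Finsupp.applyAddHom (k + 1 : ℕ)
  coroot_simple i j := by
    simp only [AddMonoidHom.sub_apply, Finsupp.applyAddHom_apply, signVec_apply, CartanMatrix.A,
      Matrix.of_apply, Fin.ext_iff]
    grind
  len _ := 1
  len_pos _ := one_pos
  len_symm i j := by
    simp only [CartanMatrix.A, Matrix.of_apply, Fin.ext_iff]
    grind
  -- This differs from the half-sum by a multiple of `(1, …, 1)`, which vanishes on the roots.
  rho := weightForm fun i ↦ -i
  rho_simple i := by rw [weightForm_signVec]; push_cast; ring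
  pos := signTriples (n + 1) {-1} ∅
  vec := signVec
  injOn := injOn_signVec (by simp) (by simp)
  rho_pos := by
    rintro ⟨i, j, s⟩ h
    simp only [mem_signTriples, Finset.mem_singleton, Finset.notMem_empty] at h
    rw [weightForm_signVec]
    grind
  simple_mem i := ⟨_, by rw [mem_signTriples]; simp, rfl⟩
  reflect_mem x hx k hk := by
    obtain ⟨y, hy, h⟩ := exists_signVec_swap (n := n + 1) (k := k) (by simp) (by omega) hx hk
    exact ⟨y, hy, h⟩
  exists_pos := by
    rintro ⟨i, j, s⟩ h
    simp only [mem_signTriples, Finset.mem_singleton, Finset.notMem_empty] at h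
    refine Or.inr ⟨⟨i, by grind⟩, ?_⟩
    simp only [AddMonoidHom.sub_apply, Finsupp.applyAddHom_apply, signVec_apply]
    grind
  high := (0, n, -1)
  high_mem := by simp only [mem_signTriples]; grind
  rho_le := by
    rintro ⟨i, j, s⟩ h
    simp only [mem_signTriples, Finset.mem_singleton, Finset.notMem_empty] at h
    rw [weightForm_signVec, weightForm_signVec]
    grind
  theta := weightForm fun i ↦ if i = 0 then 1 else if i = n then -1 else 0
  theta_simple i := by
    rw [weightForm_signVec]
    simp only [AddMonoidHom.sub_apply, Finsupp.applyAddHom_apply, signVec_apply]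
    grind

/-- A model of the root system of type `Bₙ`. -/
noncomputable def modelB (n : ℕ) (hn : 2 ≤ n) :
    RootModel (CartanMatrix.B n) (ℕ →₀ ℤ) (ℕ × ℕ × ℤ) where
  simple k := if (k : ℕ) + 1 < n then signVec (k, k + 1, -1) else signVec (k, k, 0)
  coroot k :=
    if (k : ℕ) + 1 < n then Finsupp.applyAddHom (k : ℕ) - Finsupp.applyAddHom (k + 1 : ℕ) else
    2 • Finsupp.applyAddHom (k : ℕ)
  coroot_simple i j := by
    simp only [CartanMatrix.B, Matrix.of_apply, Fin.ext_iff]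
    split_ifs <;> simp only [AddMonoidHom.sub_apply, AddMonoidHom.nsmul_apply,
      Finsupp.applyAddHom_apply, signVec_apply, nsmul_eq_mul] <;> grind
  len k := if (k : ℕ) + 1 < n then 2 else 1
  len_pos k := by split_ifs <;> simp
  len_symm i j := by
    simp only [CartanMatrix.B, Matrix.of_apply, Fin.ext_iff]
    grind
  -- Twice the usual `(n - 1/2, …, 1/2)`, so as to be integral with value 1 on the short simple
  -- root.
  rho := weightForm fun i ↦ 2 * n - 1 - 2 * i
  rho_simple i := by
    split_ifs <;> rw [weightForm_signVec] <;> grind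
  -- On the diagonal `s = 0` gives the short roots `eᵢ`.
  pos := signTriples n {1, -1} {0}
  vec := signVec
  injOn := injOn_signVec (by simp) (by simp)
  rho_pos := by
    rintro ⟨i, j, s⟩ h
    simp only [mem_signTriples, Finset.mem_singleton, Finset.mem_insert] at h
    rw [weightForm_signVec]
    grind
  simple_mem i := by
    split_ifs
    · exact ⟨_, by rw [mem_signTriples]; simp; omega, rfl⟩
    · exact ⟨_, by rw [mem_signTriples]; simp, rfl⟩
  reflect_mem x hx k hk := by
    split_ifs at hk ⊢ with h
    · exact exists_signVec_swap (by simp) h hx hk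
    · obtain ⟨i, j, s⟩ := x
      simp only [mem_signTriples, Finset.mem_singleton, Finset.mem_insert] at hx
      by_cases hj : j = k ∧ i < j
      · refine ⟨(i, j, -s),
          by simp only [mem_signTriples, Finset.mem_singleton, Finset.mem_insert]; grind, ?_⟩
        ext l
        simp only [AddMonoidHom.nsmul_apply, Finsupp.applyAddHom_apply, Finsupp.sub_apply,
          Finsupp.smul_apply, signVec_apply, nsmul_eq_mul, smul_eq_mul]
        grind
      · refine ⟨(i, j, s),
          by simp only [mem_signTriples, Finset.mem_singleton, Finset.mem_insert]; grind, ?_⟩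
        have hjk : j ≠ k := by
          rintro rfl
          obtain rfl : i = k := by omega
          exact hk (by rw [show s = 0 by grind])
        ext l
        simp only [AddMonoidHom.nsmul_apply, Finsupp.applyAddHom_apply, Finsupp.sub_apply,
          Finsupp.smul_apply, signVec_apply, nsmul_eq_mul, smul_eq_mul]
        grind
  exists_pos := by
    rintro ⟨i, j, s⟩ h
    simp only [mem_signTriples, Finset.mem_singleton, Finset.mem_insert] at h
    by_cases hs : s = -1
    · refine Or.inr ⟨⟨i, by grind⟩, ?_⟩
      dsimp only
      split_ifs <;> simp only [AddMonoidHom.sub_apply, AddMonoidHom.nsmul_apply,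
        Finsupp.applyAddHom_apply, signVec_apply, nsmul_eq_mul] <;> grind
    · refine Or.inr ⟨⟨j, by grind⟩, ?_⟩
      dsimp only
      split_ifs <;> simp only [AddMonoidHom.sub_apply, AddMonoidHom.nsmul_apply,
        Finsupp.applyAddHom_apply, signVec_apply, nsmul_eq_mul] <;> grind
  high := (0, 1, 1)
  high_mem := by simp only [mem_signTriples]; grind
  rho_le := by
    rintro ⟨i, j, s⟩ h
    simp only [mem_signTriples, Finset.mem_singleton, Finset.mem_insert] at h
    rw [weightForm_signVec, weightForm_signVec]
    grind
  theta := weightForm fun i ↦ if i < 2 then 2 else 0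
  theta_simple i := by
    split_ifs <;> rw [weightForm_signVec] <;> simp only [AddMonoidHom.sub_apply,
      AddMonoidHom.nsmul_apply, Finsupp.applyAddHom_apply, signVec_apply, nsmul_eq_mul] <;> grind

/-- A model of the root system of type `Cₙ`. -/
noncomputable def modelC (n : ℕ) (hn : 2 ≤ n) :
    RootModel (CartanMatrix.C n) (ℕ →₀ ℤ) (ℕ × ℕ × ℤ) where
  simple k := if (k : ℕ) + 1 < n then signVec (k, k + 1, -1) else signVec (k, k, 1)
  coroot k :=
    if (k : ℕ) + 1 < n then Finsupp.applyAddHom (k : ℕ) - Finsupp.applyAddHom (k + 1 : ℕ) else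
    Finsupp.applyAddHom (k : ℕ)
  coroot_simple i j := by
    simp only [CartanMatrix.C, Matrix.of_apply, Fin.ext_iff]
    split_ifs <;> simp only [AddMonoidHom.sub_apply, Finsupp.applyAddHom_apply,
      signVec_apply] <;> grind
  len k := if (k : ℕ) + 1 < n then 1 else 2
  len_pos k := by split_ifs <;> simp
  len_symm i j := by
    simp only [CartanMatrix.C, Matrix.of_apply, Fin.ext_iff]
    grind
  rho := weightForm fun i ↦ n - i
  rho_simple i := by
    split_ifs <;> rw [weightForm_signVec] <;> grind
  -- On the diagonal `s = 1` gives the long roots `2 eᵢ`.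
  pos := signTriples n {1, -1} {1}
  vec := signVec
  injOn := injOn_signVec (by simp) (by simp)
  rho_pos := by
    rintro ⟨i, j, s⟩ h
    simp only [mem_signTriples, Finset.mem_singleton, Finset.mem_insert] at h
    rw [weightForm_signVec]
    grind
  simple_mem i := by
    split_ifs
    · exact ⟨_, by rw [mem_signTriples]; simp; omega, rfl⟩
    · exact ⟨_, by rw [mem_signTriples]; simp, rfl⟩
  reflect_mem x hx k hk := by
    split_ifs at hk ⊢ with h
    · exact exists_signVec_swap (by simp) h hx hk
    · obtain ⟨i, j, s⟩ := x
      simp only [mem_signTriples, Finset.mem_singleton, Finset.mem_insert] at hx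
      by_cases hj : j = k ∧ i < j
      · refine ⟨(i, j, -s),
          by simp only [mem_signTriples, Finset.mem_singleton, Finset.mem_insert]; grind, ?_⟩
        ext l
        simp only [Finsupp.applyAddHom_apply, Finsupp.sub_apply,
          Finsupp.smul_apply, signVec_apply, smul_eq_mul]
        grind
      · refine ⟨(i, j, s),
          by simp only [mem_signTriples, Finset.mem_singleton, Finset.mem_insert]; grind, ?_⟩
        have hjk : j ≠ k := by
          rintro rfl
          obtain rfl : i = k := by omega
          exact hk (by rw [show s = 1 by grind])
        ext l
        simp only [Finsupp.applyAddHom_apply, Finsupp.sub_apply,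
          Finsupp.smul_apply, signVec_apply, smul_eq_mul]
        grind
  exists_pos := by
    rintro ⟨i, j, s⟩ h
    simp only [mem_signTriples, Finset.mem_singleton, Finset.mem_insert] at h
    by_cases hs : s = -1
    · refine Or.inr ⟨⟨i, by grind⟩, ?_⟩
      dsimp only
      split_ifs <;> simp only [AddMonoidHom.sub_apply, Finsupp.applyAddHom_apply,
        signVec_apply] <;> grind
    · refine Or.inr ⟨⟨j, by grind⟩, ?_⟩
      dsimp only
      split_ifs <;> simp only [AddMonoidHom.sub_apply, Finsupp.applyAddHom_apply,
        signVec_apply] <;> grind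
  high := (0, 0, 1)
  high_mem := by simp only [mem_signTriples]; grind
  rho_le := by
    rintro ⟨i, j, s⟩ h
    simp only [mem_signTriples, Finset.mem_singleton, Finset.mem_insert] at h
    rw [weightForm_signVec, weightForm_signVec]
    grind
  theta := weightForm fun i ↦ if i = 0 then 2 else 0
  theta_simple i := by
    split_ifs <;> rw [weightForm_signVec] <;> simp only [AddMonoidHom.sub_apply,
      Finsupp.applyAddHom_apply, signVec_apply] <;> grind

end RootModel

namespace RootModel

/-- A model of the root system of type `Dₙ`. -/
noncomputable def modelD (n : ℕ) (hn : 3 ≤ n) :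
    RootModel (CartanMatrix.D n) (ℕ →₀ ℤ) (ℕ × ℕ × ℤ) where
  simple k := if (k : ℕ) + 1 < n then signVec (k, k + 1, -1) else signVec (k - 1, k, 1)
  coroot k :=
    if (k : ℕ) + 1 < n then Finsupp.applyAddHom (k : ℕ) - Finsupp.applyAddHom (k + 1 : ℕ) else
    Finsupp.applyAddHom (k - 1 : ℕ) + Finsupp.applyAddHom (k : ℕ)
  coroot_simple i j := by
    simp only [CartanMatrix.D, Matrix.of_apply, Fin.ext_iff]
    split_ifs <;> simp only [AddMonoidHom.sub_apply, AddMonoidHom.add_apply,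
      Finsupp.applyAddHom_apply, signVec_apply] <;> grind
  len _ := 1
  len_pos _ := one_pos
  len_symm i j := by
    simp only [CartanMatrix.D, Matrix.of_apply, Fin.ext_iff]
    grind
  rho := weightForm fun i ↦ n - 1 - i
  rho_simple i := by
    split_ifs <;> rw [weightForm_signVec] <;> grind
  pos := signTriples n {1, -1} ∅
  vec := signVec
  injOn := injOn_signVec (by simp) (by simp)
  rho_pos := by
    rintro ⟨i, j, s⟩ h
    simp only [mem_signTriples, Finset.mem_singleton, Finset.mem_insert,
        Finset.notMem_empty] at h
    rw [weightForm_signVec]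
    grind
  simple_mem i := by
    split_ifs
    · exact ⟨_, by rw [mem_signTriples]; simp; omega, rfl⟩
    · exact ⟨_, by rw [mem_signTriples]; simp; omega, rfl⟩
  reflect_mem x hx k hk := by
    split_ifs at hk ⊢ with h
    · exact exists_signVec_swap (by simp) h hx hk
    · obtain ⟨i, j, s⟩ := x
      simp only [mem_signTriples, Finset.mem_singleton, Finset.mem_insert,
        Finset.notMem_empty] at hx
      -- Here `k = n - 1`, and the reflection sends `e_(k-1)` to `-e_k` and `e_k` to `-e_(k-1)`. The
      -- cases below record which of these two indices occur among `i` and `j`.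
      have key (i' j' : ℕ) (s' : ℤ) (h : i' < j') (hj : j' < n) (hs : s' = 1 ∨ s' = -1)
          (hv : ∀ l, signVec (i', j', s') l = signVec (i, j, s) l -
            (signVec (i, j, s) (k - 1) + signVec (i, j, s) k) * signVec (k - 1, k, 1) l) :
          ∃ y ∈ signTriples n {1, -1} ∅, signVec y = signVec (i, j, s) -
            (Finsupp.applyAddHom (k - 1 : ℕ) + Finsupp.applyAddHom (k : ℕ) :
              (ℕ →₀ ℤ) →+ ℤ) (signVec (i, j, s)) • signVec (k - 1, k, 1) :=
        ⟨(i', j', s'), mem_signTriples.mpr (Or.inl ⟨h, hj, by simpa using hs⟩),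
          Finsupp.ext fun l ↦ by
            rw [hv]
            rfl⟩
      simp only [signVec_apply] at key
      by_cases h1 : j + 1 < k
      · exact key i j s (by grind) (by grind) (by grind) (by grind)
      by_cases h2 : j + 1 = k
      · exact key i (j + 1) (-s) (by grind) (by grind) (by grind) (by grind)
      by_cases h3 : i + 1 = k
      · have hs : s = -1 := by
          by_contra hs
          refine hk ?_
          rw [show i = k - 1 by grind, show j = k by grind, show s = 1 by grind]
        exact key i j s (by grind) (by grind) (by grind) (by grind)
      · exact key i (j - 1) (-s) (by grind) (by grind) (by grind) (by grind)
  exists_pos := by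
    rintro ⟨i, j, s⟩ h
    simp only [mem_signTriples, Finset.mem_singleton, Finset.mem_insert,
        Finset.notMem_empty] at h
    by_cases hs : s = -1
    · refine Or.inr ⟨⟨i, by grind⟩, ?_⟩
      dsimp only
      split_ifs <;> simp only [AddMonoidHom.sub_apply, AddMonoidHom.add_apply,
        Finsupp.applyAddHom_apply, signVec_apply] <;> grind
    · refine Or.inr ⟨⟨j, by grind⟩, ?_⟩
      dsimp only
      split_ifs <;> simp only [AddMonoidHom.sub_apply, AddMonoidHom.add_apply,
        Finsupp.applyAddHom_apply, signVec_apply] <;> grind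
  high := (0, 1, 1)
  high_mem := by simp only [mem_signTriples]; grind
  rho_le := by
    rintro ⟨i, j, s⟩ h
    simp only [mem_signTriples, Finset.mem_singleton, Finset.mem_insert,
        Finset.notMem_empty] at h
    rw [weightForm_signVec, weightForm_signVec]
    grind
  theta := weightForm fun i ↦ if i < 2 then 1 else 0
  theta_simple i := by
    split_ifs <;> rw [weightForm_signVec] <;> simp only [AddMonoidHom.sub_apply,
      AddMonoidHom.add_apply, Finsupp.applyAddHom_apply, signVec_apply] <;> grind

end RootModel

/-! ### Telescoping products for the classical types -/

namespace Finset

variable {F : Type*} [Field F] {f : ℤ → F} (hf : ∀ k, f k ≠ 0)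

include hf

lemma prod_range_div_of_desc {u v : ℕ → ℤ} (h : ∀ j, u (j + 1) = v j) (n : ℕ) :
    ∏ j ∈ range n, f (u j) / f (v j) = f (u 0) / f (u n) := by
  induction n with
  | zero => simp [hf]
  | succ n ih =>
    have := hf (u n)
    rw [prod_range_succ, ih, h]
    field_simp

lemma prod_range_div_of_asc {u v : ℕ → ℤ} (h : ∀ j, u j = v (j + 1)) (n : ℕ) :
    ∏ j ∈ range n, f (u j) / f (v j) = f (v n) / f (v 0) := by
  induction n with
  | zero => simp [hf]
  | succ n ih =>
    have := hf (v n)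
    rw [prod_range_succ, ih, h]
    field_simp

/-- A shift by two steps leaves two factors at either end. It occurs in type C, where `θ = 2 e₀`
while consecutive weights differ by 1. -/
lemma prod_range_div_of_desc_two {u v : ℕ → ℤ} (h : ∀ j, u (j + 2) = v j) (n : ℕ) :
    ∏ j ∈ range n, f (u j) / f (v j) = f (u 0) * f (u 1) / (f (u n) * f (u (n + 1))) := by
  induction n with
  | zero => simp [hf]
  | succ n ih =>
    have := hf (u n)
    have := hf (u (n + 1))
    rw [prod_range_succ, ih, ← h]
    field_simp

lemma prod_range_div_of_asc_two {u v : ℕ → ℤ} (h : ∀ j, u j = v (j + 2)) (n : ℕ) :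
    ∏ j ∈ range n, f (u j) / f (v j) = f (v n) * f (v (n + 1)) / (f (v 0) * f (v 1)) := by
  induction n with
  | zero => simp [hf]
  | succ n ih =>
    have := hf (v n)
    have := hf (v (n + 1))
    rw [prod_range_succ, ih, h]
    field_simp

omit hf in
-- In types B and D the highest root is `e₀ + e₁`, so pairs of indices that are both at least 2
-- contribute trivially.
lemma prod_range_ite_lt {R : ℕ → ℕ → F} (hR : ∀ i j, 2 ≤ i → i < j → R i j = 1) (n : ℕ) :
    ∏ i ∈ range (n + 2), ∏ j ∈ range (n + 2), (if i < j then R i j else 1) =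
      R 0 1 * (∏ j ∈ range n, R 0 (j + 2)) * ∏ j ∈ range n, R 1 (j + 2) := by
  rw [prod_range_succ', prod_range_succ', prod_eq_one (s := range n)]
  · simp only [prod_range_succ', zero_add, one_mul, Nat.lt_add_left_iff_pos]
    simp
    ring
  · intro i _
    refine prod_eq_one fun j _ ↦ ?_
    split_ifs with h
    · exact hR _ _ (by omega) h
    · rfl

end Finset

/-- The factor at `eᵢ + s eⱼ` of a product over a set of vectors. -/
noncomputable def signFactor {F : Type*} [Field F] (f : ℤ → F) (r t : ℕ → ℤ) (x : ℕ × ℕ × ℤ) : F :=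
  f (weightForm r (signVec x) + weightForm t (signVec x)) / f (weightForm r (signVec x))

lemma signFactor_apply {F : Type*} [Field F] (f : ℤ → F) (r t : ℕ → ℤ) (i j : ℕ) (s : ℤ) :
    signFactor f r t (i, j, s) =
      f (r i + s * r j + (t i + s * t j)) / f (r i + s * r j) := by
  rw [signFactor, weightForm_signVec, weightForm_signVec]

section signFactor

variable {F : Type*} [Field F] {f : ℤ → F} (hf : ∀ k, f k ≠ 0)

include hf

/-- For fixed `i < 2` and sign `s`, adding `θ` moves the argument by exactly one step of the
progression in `j`, so each of the four products telescopes. The roots `e₀ ± e₁`, `e₀` and `e₁`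
supply the other nontrivial factors. -/
lemma prod_signFactor_B (n : ℕ) :
    ∏ x ∈ signTriples (n + 2) {1, -1} {0}, signFactor f (fun i ↦ 2 * (n + 2 : ℕ) - 1 - 2 * i)
      (fun i ↦ if i < 2 then 2 else 0) x =
    f (4 * n + 8) * f (4 * n + 2) * f (2 * n + 5) / (f 2 * f 4 * f (2 * n + 1)) := by
  have h1 (i : ℕ) (hi : i < 2) (s : ℤ) : ∏ j ∈ Finset.range n, signFactor f
      (fun i ↦ 2 * (n + 2 : ℕ) - 1 - 2 * i) (fun i ↦ if i < 2 then 2 else 0) (i, j + 2, s) =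
      ∏ j ∈ Finset.range n, f (2 * n + 5 - 2 * i + s * (2 * n - 1 - 2 * j)) /
        f (2 * n + 3 - 2 * i + s * (2 * n - 1 - 2 * j)) := by
    refine Finset.prod_congr rfl fun j _ ↦ ?_
    rw [signFactor_apply, if_pos hi, if_neg (by omega)]
    congr 2 <;> (push_cast; ring)
  have hp (i : ℕ) := Finset.prod_range_div_of_desc hf
    (u := fun j ↦ 2 * n + 5 - 2 * i + 1 * (2 * n - 1 - 2 * j))
    (v := fun j ↦ 2 * n + 3 - 2 * i + 1 * (2 * n - 1 - 2 * j)) (fun j ↦ by push_cast; ring) n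
  have hm (i : ℕ) := Finset.prod_range_div_of_asc hf
    (u := fun j ↦ 2 * n + 5 - 2 * i + -1 * (2 * n - 1 - 2 * j))
    (v := fun j ↦ 2 * n + 3 - 2 * i + -1 * (2 * n - 1 - 2 * j)) (fun j ↦ by push_cast; ring) n
  rw [prod_signTriples, Finset.prod_range_ite_lt, Finset.prod_range_succ', Finset.prod_range_succ',
    Finset.prod_eq_one (s := Finset.range n) (f := fun i ↦ ∏ s ∈ {(0 : ℤ)}, _)]
  · simp only [Finset.prod_pair (show (1 : ℤ) ≠ -1 by decide), Finset.prod_mul_distrib]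
    rw [h1 0 zero_lt_two, h1 0 zero_lt_two, h1 1 one_lt_two, h1 1 one_lt_two, hp, hp, hm, hm]
    simp only [Finset.prod_singleton, signFactor_apply]
    simp
    ring_nf
    field_simp [hf]
  · intro i _
    rw [Finset.prod_singleton, signFactor_apply]
    simp [hf]
  · intro i j hi hij
    refine Finset.prod_eq_one fun s _ ↦ ?_
    rw [signFactor_apply, if_neg (by omega), if_neg (by omega)]
    simp [hf]

lemma prod_signFactor_D (n : ℕ) :
    ∏ x ∈ signTriples (n + 2) {1, -1} ∅, signFactor f (fun i ↦ (n + 2 : ℕ) - 1 - i)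
      (fun i ↦ if i < 2 then 1 else 0) x =
    f (n + 2) * f (2 * n) * f (2 * n + 3) / (f 1 * f 2 * f n) := by
  have h1 (i : ℕ) (hi : i < 2) (s : ℤ) : ∏ j ∈ Finset.range n, signFactor f
      (fun i ↦ (n + 2 : ℕ) - 1 - i) (fun i ↦ if i < 2 then 1 else 0) (i, j + 2, s) =
      ∏ j ∈ Finset.range n, f (n + 2 - i + s * (n - 1 - j)) /
        f (n + 1 - i + s * (n - 1 - j)) := by
    refine Finset.prod_congr rfl fun j _ ↦ ?_
    rw [signFactor_apply, if_pos hi, if_neg (by omega)]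
    congr 2 <;> (push_cast; ring)
  have hp (i : ℕ) := Finset.prod_range_div_of_desc hf
    (u := fun j ↦ n + 2 - i + 1 * (n - 1 - j))
    (v := fun j ↦ n + 1 - i + 1 * (n - 1 - j)) (fun j ↦ by push_cast; ring) n
  have hm (i : ℕ) := Finset.prod_range_div_of_asc hf
    (u := fun j ↦ n + 2 - i + -1 * (n - 1 - j))
    (v := fun j ↦ n + 1 - i + -1 * (n - 1 - j)) (fun j ↦ by push_cast; ring) n
  rw [prod_signTriples, Finset.prod_range_ite_lt,
    Finset.prod_eq_one (s := Finset.range (n + 2)) (f := fun i ↦ ∏ s ∈ (∅ : Finset ℤ), _)]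
  · simp only [Finset.prod_pair (show (1 : ℤ) ≠ -1 by decide), Finset.prod_mul_distrib]
    rw [h1 0 zero_lt_two, h1 0 zero_lt_two, h1 1 one_lt_two, h1 1 one_lt_two, hp, hp, hm, hm]
    simp only [signFactor_apply]
    simp
    ring_nf
    field_simp [hf]
  · simp
  · intro i j hi hij
    refine Finset.prod_eq_one fun s _ ↦ ?_
    rw [signFactor_apply, if_neg (by omega), if_neg (by omega)]
    simp [hf]

lemma prod_signFactor_C (n : ℕ) :
    ∏ x ∈ signTriples (n + 1) {1, -1} {1}, signFactor f (fun i ↦ (n + 1 : ℕ) - i)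
      (fun i ↦ if i = 0 then 2 else 0) x =
    f (n + 1) * f (2 * n + 3) * f (2 * n + 6) / (f 1 * f 2 * f (n + 3)) := by
  have h1 (s : ℤ) : ∏ j ∈ Finset.range n, signFactor f
      (fun i ↦ (n + 1 : ℕ) - i) (fun i ↦ if i = 0 then 2 else 0) (0, j + 1, s) =
      ∏ j ∈ Finset.range n, f (n + 3 + s * (n - j)) / f (n + 1 + s * (n - j)) := by
    refine Finset.prod_congr rfl fun j _ ↦ ?_
    rw [signFactor_apply, if_pos rfl, if_neg (by omega)]
    congr 2 <;> (push_cast; ring)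
  have hp := Finset.prod_range_div_of_desc_two hf (u := fun j ↦ n + 3 + 1 * (n - j))
    (v := fun j ↦ n + 1 + 1 * (n - j)) (fun j ↦ by push_cast; ring) n
  have hm := Finset.prod_range_div_of_asc_two hf (u := fun j ↦ n + 3 + -1 * (n - j))
    (v := fun j ↦ n + 1 + -1 * (n - j)) (fun j ↦ by push_cast; ring) n
  rw [prod_signTriples, Finset.prod_range_succ' (fun i ↦ ∏ s ∈ {(1 : ℤ)}, _),
    Finset.prod_eq_one (s := Finset.range n) (f := fun i ↦ ∏ s ∈ {(1 : ℤ)}, _),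
    Finset.prod_range_succ',
    Finset.prod_eq_one (s := Finset.range n) (f := fun i ↦ ∏ j ∈ Finset.range (n + 1), _),
    Finset.prod_range_succ']
  · simp only [Finset.prod_pair (show (1 : ℤ) ≠ -1 by decide), Finset.prod_mul_distrib,
      Nat.succ_pos, if_true, lt_irrefl, if_false]
    rw [h1, h1, hp, hm]
    simp only [Finset.prod_singleton, signFactor_apply]
    simp
    ring_nf
    field_simp [hf]
  · intro i _
    refine Finset.prod_eq_one fun j _ ↦ ?_
    split_ifs with h
    · refine Finset.prod_eq_one fun s _ ↦ ?_
      rw [signFactor_apply, if_neg (by omega), if_neg (by omega)]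
      simp [hf]
    · rfl
  · intro i _
    rw [Finset.prod_singleton, signFactor_apply]
    simp [hf]

/-- With `θ = e₀ - e_(n+1)`, only roots involving `e₀` or `e_(n+1)` matter: one telescoping product
for each index, and the corner root `θ` itself. -/
lemma prod_signFactor_A (n : ℕ) :
    ∏ x ∈ signTriples (n + 2) {-1} ∅, signFactor f (fun i ↦ -i)
      (fun i ↦ if i = 0 then 1 else if i = n + 1 then -1 else 0) x =
    f (n + 3) * f (n + 1) / (f 1 * f 1) := by
  have hl : ∏ j ∈ Finset.range n, signFactor f (fun i ↦ -i)
      (fun i ↦ if i = 0 then 1 else if i = n + 1 then -1 else 0) (0, j + 1, -1) =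
      ∏ j ∈ Finset.range n, f (j + 2) / f (j + 1) := by
    refine Finset.prod_congr rfl fun j hj ↦ ?_
    rw [Finset.mem_range] at hj
    rw [signFactor_apply, if_pos rfl, if_neg (by omega), if_neg (by omega)]
    congr 2 <;> (push_cast; ring)
  have hr : ∏ i ∈ Finset.range n, signFactor f (fun i ↦ -i)
      (fun i ↦ if i = 0 then 1 else if i = n + 1 then -1 else 0) (i + 1, n + 1, -1) =
      ∏ j ∈ Finset.range n, f (n + 1 - j) / f (n - j) := by
    refine Finset.prod_congr rfl fun i hi ↦ ?_
    rw [Finset.mem_range] at hi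
    rw [signFactor_apply, if_neg (by omega), if_neg (by omega), if_neg (by omega), if_pos rfl]
    congr 2 <;> (push_cast; ring)
  have hp := Finset.prod_range_div_of_asc hf (u := fun j ↦ j + 2) (v := fun j ↦ j + 1)
    (fun j ↦ by push_cast; ring) n
  have hm := Finset.prod_range_div_of_desc hf (u := fun j ↦ n + 1 - j) (v := fun j ↦ n - j)
    (fun j ↦ by push_cast; ring) n
  have hi (i : ℕ) (hi : i ∈ Finset.range n) : (∏ j ∈ Finset.range (n + 1 + 1),
      if i + 1 < j then ∏ s ∈ {(-1 : ℤ)}, signFactor f (fun i ↦ -i)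
        (fun i ↦ if i = 0 then 1 else if i = n + 1 then -1 else 0) (i + 1, j, s) else 1) =
      signFactor f (fun i ↦ -i)
        (fun i ↦ if i = 0 then 1 else if i = n + 1 then -1 else 0) (i + 1, n + 1, -1) := by
    rw [Finset.mem_range] at hi
    rw [Finset.prod_range_succ, if_pos (by omega), Finset.prod_singleton, Finset.prod_eq_one,
      one_mul]
    intro j hj
    rw [Finset.mem_range] at hj
    split_ifs with h
    · rw [Finset.prod_singleton, signFactor_apply, if_neg (by omega), if_neg (by omega),
        if_neg (by omega), if_neg (by omega)]
      simp [hf]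
    · rfl
  have hlast : (∏ j ∈ Finset.range (n + 1 + 1),
      if n + 1 < j then ∏ s ∈ {(-1 : ℤ)}, signFactor f (fun i ↦ -i)
        (fun i ↦ if i = 0 then 1 else if i = n + 1 then -1 else 0) (n + 1, j, s) else 1) = 1 := by
    refine Finset.prod_eq_one fun j hj ↦ ?_
    rw [Finset.mem_range] at hj
    rw [if_neg (by omega)]
  rw [prod_signTriples, Finset.prod_range_succ', Finset.prod_range_succ, hlast,
    Finset.prod_congr rfl hi, hr, hm, Finset.prod_range_succ, Finset.prod_range_succ']
  simp only [Finset.prod_singleton, Nat.succ_pos, if_true, lt_irrefl, if_false]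
  rw [hl, hp]
  simp only [signFactor_apply, Finset.prod_empty, Finset.prod_const_one]
  simp
  ring_nf
  field_simp [hf]

end signFactor

/-! ### The products for the classical models in terms of the rank -/

namespace RootModel

section

variable (K : Type*) [Field K]

lemma product_modelA (n : ℕ) (hn : 1 ≤ n) : (modelA n hn).product K 1 =
    quadFactor 1 (n + 2) * quadFactor 1 n / (quadFactor 1 1 * quadFactor 1 1) := by
  obtain ⟨n, rfl⟩ := Nat.exists_eq_add_of_le' hn
  refine (prod_signFactor_A (quadFactor.ne_zero (K := K) 1) n).trans ?_
  push_cast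
  ring_nf

lemma product_modelB (n : ℕ) (hn : 2 ≤ n) : (modelB n hn).product K 2 =
    quadFactor 2 (4 * n) * quadFactor 2 (4 * n - 6) * quadFactor 2 (2 * n + 1) /
      (quadFactor 2 2 * quadFactor 2 4 * quadFactor 2 (2 * n - 3)) := by
  obtain ⟨n, rfl⟩ := Nat.exists_eq_add_of_le' hn
  refine (prod_signFactor_B (quadFactor.ne_zero (K := K) 2) n).trans ?_
  push_cast
  ring_nf

lemma product_modelC (n : ℕ) (hn : 2 ≤ n) : (modelC n hn).product K 2 =
    quadFactor 2 n * quadFactor 2 (2 * n + 1) * quadFactor 2 (2 * n + 4) /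
      (quadFactor 2 1 * quadFactor 2 2 * quadFactor 2 (n + 2)) := by
  obtain ⟨n, rfl⟩ := Nat.exists_eq_add_of_le' (one_le_two.trans hn)
  refine (prod_signFactor_C (quadFactor.ne_zero (K := K) 2) n).trans ?_
  push_cast
  ring_nf

lemma product_modelD (n : ℕ) (hn : 3 ≤ n) : (modelD n hn).product K 1 =
    quadFactor 1 n * quadFactor 1 (2 * n - 4) * quadFactor 1 (2 * n - 1) /
      (quadFactor 1 1 * quadFactor 1 2 * quadFactor 1 (n - 2)) := by
  obtain ⟨n, rfl⟩ := Nat.exists_eq_add_of_le' (Nat.le_of_succ_le hn)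
  refine (prod_signFactor_D (quadFactor.ne_zero (K := K) 1) n).trans ?_
  push_cast
  ring_nf

end

lemma theta_high_modelA (n : ℕ) (hn : 1 ≤ n) :
    (modelA n hn).theta ((modelA n hn).vec (modelA n hn).high) = 2 * 1 :=
  (weightForm_signVec _ _ _ _).trans (by
    obtain ⟨n, rfl⟩ := Nat.exists_eq_add_of_le' hn
    simp)

lemma theta_high_modelB (n : ℕ) (hn : 2 ≤ n) :
    (modelB n hn).theta ((modelB n hn).vec (modelB n hn).high) = 2 * 2 :=
  (weightForm_signVec _ _ _ _).trans (by simp)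

lemma theta_high_modelC (n : ℕ) (hn : 2 ≤ n) :
    (modelC n hn).theta ((modelC n hn).vec (modelC n hn).high) = 2 * 2 :=
  (weightForm_signVec _ _ _ _).trans (by simp)

lemma theta_high_modelD (n : ℕ) (hn : 3 ≤ n) :
    (modelD n hn).theta ((modelD n hn).vec (modelD n hn).high) = 2 * 1 :=
  (weightForm_signVec _ _ _ _).trans (by simp)

end RootModel

/-! ### Comparison with Vogel's parameters -/

lemma vogelFactor_mul_mul_eq {K : Type*} [Field K] [CharZero K] {N : ℤ} {a₁ a₂ a₃ c₁ c₂ c₃ : ℤ}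
    {t x₁ x₂ x₃ : K}
    (h₁ : (2 * t - x₁) ^ 2 = (2 * (a₁ / N)) ^ 2) (h₁' : x₁ ^ 2 = (2 * (c₁ / N)) ^ 2)
    (h₂ : (2 * t - x₂) ^ 2 = (2 * (a₂ / N)) ^ 2) (h₂' : x₂ ^ 2 = (2 * (c₂ / N)) ^ 2)
    (h₃ : (2 * t - x₃) ^ 2 = (2 * (a₃ / N)) ^ 2) (h₃' : x₃ ^ 2 = (2 * (c₃ / N)) ^ 2) :
    vogelFactor t x₁ * vogelFactor t x₂ * vogelFactor t x₃ =
      (([a₁, a₂, a₃] : List ℤ).map (quadFactor N)).prod /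
        (([c₁, c₂, c₃] : List ℤ).map (quadFactor N)).prod := by
  rw [quadFactor.vogelFactor_eq h₁ h₁', quadFactor.vogelFactor_eq h₂ h₂',
    quadFactor.vogelFactor_eq h₃ h₃']
  simp only [List.map_cons, List.map_nil, List.prod_cons, List.prod_nil, mul_one]
  field_simp [quadFactor.ne_zero]

theorem proposition1 {ι K M N : Type*} [Fintype ι] [Field K] [CharZero K]
    [AddCommGroup M] [Module K M] [AddCommGroup N] [Module K N]
    (P : RootPairing ι K M N) [P.IsRootSystem] [P.IsCrystallographic] [P.IsReduced]
    [P.IsIrreducible] (b : P.Base) (B : P.InvariantForm)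
    (θ : ι) (hθ : b.IsHighestRoot θ) (hB : B.form (P.root θ) (P.root θ) = 2) :
    (∃ T : SimpleType, b.HasType T) ∧
    ∀ T : SimpleType, b.HasType T →
      b.casimirProduct B (P.root θ) =
        vogelFactor (T.vogelT K) (T.vogelAlpha K) *
        vogelFactor (T.vogelT K) (T.vogelBeta K) *
        vogelFactor (T.vogelT K) (T.vogelGamma K) := by
  have : Nonempty ι := ⟨θ⟩
  refine ⟨b.exists_hasType, fun T ⟨e, he⟩ ↦ ?_⟩
  cases T with
  | A n hn =>
    rw [RootModel.casimirProduct_eq b B (RootModel.modelA n hn) e he hθ hB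
      (RootModel.theta_high_modelA n hn)]
    refine (RootModel.product_modelA K n hn).trans ?_
    -- In type A `t = γ`, so the third factor is 1. Since `γ / 2 = (n + 1) / 2` may be
    -- half-integral, it is written with denominator 2.
    rw [quadFactor.vogelFactor_eq (N := 1) (a := n + 2) (c := 1),
      quadFactor.vogelFactor_eq (N := 1) (a := n) (c := 1),
      quadFactor.vogelFactor_eq (N := 2) (a := n + 1) (c := n + 1)]
    · field_simp [quadFactor.ne_zero]
    all_goals
      simp only [SimpleType.vogelT, SimpleType.vogelAlpha, SimpleType.vogelBeta,
        SimpleType.vogelGamma]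
      push_cast
      ring
  | B n hn =>
    rw [RootModel.casimirProduct_eq b B (RootModel.modelB n hn) e he hθ hB
      (RootModel.theta_high_modelB n hn)]
    refine (RootModel.product_modelB K n hn).trans ?_
    rw [vogelFactor_mul_mul_eq (N := 2) (a₁ := 4 * n) (c₁ := 2) (a₂ := 4 * n - 6) (c₂ := 4)
      (a₃ := 2 * n + 1) (c₃ := 2 * n - 3)]
    · simp only [List.map_cons, List.map_nil, List.prod_cons, List.prod_nil, mul_one, mul_assoc]
    all_goals
      simp only [SimpleType.vogelT, SimpleType.vogelAlpha, SimpleType.vogelBeta,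
        SimpleType.vogelGamma]
      push_cast
      ring
  | C n hn =>
    rw [RootModel.casimirProduct_eq b B (RootModel.modelC n hn) e he hθ hB
      (RootModel.theta_high_modelC n hn)]
    refine (RootModel.product_modelC K n hn).trans ?_
    rw [vogelFactor_mul_mul_eq (N := 2) (a₁ := 2 * n + 4) (c₁ := 2) (a₂ := 2 * n + 1) (c₂ := 1)
      (a₃ := n) (c₃ := n + 2)]
    · simp only [List.map_cons, List.map_nil, List.prod_cons, List.prod_nil, mul_one]
      field_simp [quadFactor.ne_zero]
    all_goals
      simp only [SimpleType.vogelT, SimpleType.vogelAlpha, SimpleType.vogelBeta,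
        SimpleType.vogelGamma]
      push_cast
      ring
  | D n hn =>
    rw [RootModel.casimirProduct_eq b B (RootModel.modelD n hn) e he hθ hB
      (RootModel.theta_high_modelD n hn)]
    refine (RootModel.product_modelD K n hn).trans ?_
    rw [vogelFactor_mul_mul_eq (N := 1) (a₁ := 2 * n - 1) (c₁ := 1) (a₂ := 2 * n - 4) (c₂ := 2)
      (a₃ := n) (c₃ := n - 2)]
    · simp only [List.map_cons, List.map_nil, List.prod_cons, List.prod_nil, mul_one]
      field_simp [quadFactor.ne_zero]
    all_goals
      simp only [SimpleType.vogelT, SimpleType.vogelAlpha, SimpleType.vogelBeta,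
        SimpleType.vogelGamma]
      push_cast
      ring
  | G₂ =>
    rw [RootModel.casimirProduct_eq b B RootModel.modelG₂ e he hθ hB
      RootModel.theta_high_modelG₂]
    refine RootModel.product_modelG₂.trans (vogelFactor_mul_mul_eq ?_ ?_ ?_ ?_ ?_ ?_).symm <;>
      norm_num [SimpleType.vogelT, SimpleType.vogelAlpha, SimpleType.vogelBeta,
        SimpleType.vogelGamma]
  | F₄ =>
    rw [RootModel.casimirProduct_eq b B RootModel.modelF₄ e he hθ hB
      RootModel.theta_high_modelF₄]
    refine RootModel.product_modelF₄.trans (vogelFactor_mul_mul_eq ?_ ?_ ?_ ?_ ?_ ?_).symm <;>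
      norm_num [SimpleType.vogelT, SimpleType.vogelAlpha, SimpleType.vogelBeta,
        SimpleType.vogelGamma]
  | E₆ =>
    rw [RootModel.casimirProduct_eq b B RootModel.modelE₆ e he hθ hB
      RootModel.theta_high_modelE₆]
    refine RootModel.product_modelE₆.trans (vogelFactor_mul_mul_eq ?_ ?_ ?_ ?_ ?_ ?_).symm <;>
      norm_num [SimpleType.vogelT, SimpleType.vogelAlpha, SimpleType.vogelBeta,
        SimpleType.vogelGamma]
  | E₇ =>
    rw [RootModel.casimirProduct_eq b B RootModel.modelE₇ e he hθ hB
      RootModel.theta_high_modelE₇]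
    refine RootModel.product_modelE₇.trans (vogelFactor_mul_mul_eq ?_ ?_ ?_ ?_ ?_ ?_).symm <;>
      norm_num [SimpleType.vogelT, SimpleType.vogelAlpha, SimpleType.vogelBeta,
        SimpleType.vogelGamma]
  | E₈ =>
    rw [RootModel.casimirProduct_eq b B RootModel.modelE₈ e he hθ hB
      RootModel.theta_high_modelE₈]
    refine RootModel.product_modelE₈.trans (vogelFactor_mul_mul_eq ?_ ?_ ?_ ?_ ?_ ?_).symm <;>
      norm_num [SimpleType.vogelT, SimpleType.vogelAlpha, SimpleType.vogelBeta,
        SimpleType.vogelGamma]
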